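/- **Setting.** Let $\tau>0$, let $X$ be a complex Banach space and let $U_0,U_{d0},Y_0$ be complex Hilbert spaces. Write $U=L^2(0,\tau;U_0)$ and $Y=L^2(0,\tau;Y_0)$. A *$\tau$-periodic system* $\dot x=A(t)x+B(t)u+B_d(t)w$, $x(0)=x_0$, $y=C(t)x+D(t)u$, on these spaces is given by a strongly continuous evolution family $U_A(t,s)\in\mathcal L(X)$, $t\ge s$, (that is, $U_A(t,t)=I$, $U_A(t,r)U_A(r,s)=U_A(t,s)$ for $t\ge r\ge s$, and $(t,s)\mapsto U_A(t,s)x$ is continuous for every $x$) with $U_A(t+\tau,s+\tau)=U_A(t,s)$, and by $\tau$-periodic functions $B\in L^\infty(\mathbb R,\mathcal L(U_0,X))$, $B_d\in L^\infty(\mathbb R,\mathcal L(U_{d0},X))$, $C\in L^\infty(\mathbb R,\mathcal L(X,Y_0))$, $D\in L^\infty(\mathbb R,\mathcal L(U_0,Y_0))$. Its mild state and output for $t\ge0$ are $$x(t)=U_A(t,0)x_0+\int_0^tU_A(t,s)\bigl(B(s)u(s)+B_d(s)w(s)\bigr)ds,\qquad y(t)=C(t)x(t)+D(t)u(t).$$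 The system is *exponentially stable* if there are $M,\omega>0$ with $\|U_A(t,s)\|\le Me^{-\omega(t-s)}$ for all $t\ge s$. In that case $I-U_A(\tau,0)$ is boundedly invertible, and with $G_A(t,s)=U_A(t,0)(I-U_A(\tau,0))^{-1}U_A(\tau,s)$ one defines $\mathcal P\in\mathcal L(U,Y)$ by $$\mathcal Pu=C(\cdot)\int_0^\tau G_A(\cdot,s)B(s)u(s)\,ds+C(\cdot)\int_0^{\cdot}U_A(\cdot,s)B(s)u(s)\,ds+D(\cdot)u(\cdot).$$ A *controller* on a Banach space $Z$ consists of $G_1\in\mathcal L(Z)$, $G_2\in\mathcal L(Y,Z)$, $K\in\mathcal L(Z,U)$. For a $\tau$-periodic reference signal $y_{ref}\in L^2_{loc}(0,\infty;Y_0)$, a $\tau$-periodic disturbance $w\in L^2_{loc}(0,\infty;U_{d0})$ and initial states $x_0\in X$, $z_0\in Z$, the *closed loop* is determined by $$u(n\tau+\cdot)=Kz_n\ \text{ on }[0,\tau),\qquad z_{n+1}=G_1z_n+G_2\bigl(y(n\tau+\cdot)-y_{ref}(\cdot)\bigr),\qquad n\ge0.$$ It is *exponentially stable* if there are $M_0,M_1,\alpha_0,\alpha_1>0$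 such that for $y_{ref}=0$, $w=0$ and all $x_0,z_0$ one has $\|x(t)\|\le M_0e^{-\alpha_0t}(\|x_0\|+\|z_0\|)$ for $t\ge0$ and $\|z_n\|\le M_1e^{-\alpha_1n}(\|x_0\|+\|z_0\|)$ for $n\ge0$. Let $y_{ref}$ and $w^1,\dots,w^q$ be $\tau$-periodic and locally square integrable. The controller *solves the robust output regulation problem* (for the system and these signals) if 1. the closed loop is exponentially stable; 2. there are $M,\alpha>0$ such that for all $x_0\in X$, $z_0\in Z$, $v\in\mathbb C^q$, with the disturbance $w=\sum_{k=1}^qv_kw^k$, and for all $n\ge0$, $$\int_{n\tau}^{(n+1)\tau}\|y(t)-y_{ref}(t)\|^2dt\le M^2e^{-2\alpha n}\bigl(\|x_0\|^2+\|z_0\|^2+\|v\|^2+1\bigr);$$ 3. property 2 holds (with constants $M,\alpha>0$ that may change) whenever $y_{ref},w^1,\dots,w^q$ are replaced by arbitrary $\tau$-periodic locally square integrable signals $\tilde y_{ref},\tilde w^1,\dots,\tilde w^{\tilde q}$ and the system by any $\tau$-periodic system on the same spaces for which the closed loop with the same controller is exponentially stable. **Theorem.** Assume that the system is exponentially stable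 and that $\mathcal P\in\mathcal L(U,Y)$ is surjective. Choose $Z=Y=L^2(0,\tau;Y_0)$ and $G_1=I\in\mathcal L(Z)$, let $G_2\in\mathcal L(Y,Z)$ be boundedly invertible, and let $K_0\in\mathcal L(Y,U)$ be such that every $\mu\in\sigma(G_2\mathcal PK_0)$ satisfies $\operatorname{Re}\mu<0$. Then there exists $\varepsilon^*>0$ such that for every $0<\varepsilon\le\varepsilon^*$ the controller $(G_1,G_2,K)$ with $K=\varepsilon K_0$ solves the robust output regulation problem for all $\tau$-periodic $y_{ref}\in L^2_{loc}(0,\infty;Y_0)$ and $w^1,\dots,w^q\in L^2_{loc}(0,\infty;U_{d0})$, $q\ge0$. -/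

import Mathlib

open MeasureTheory Set Filter Topology
open scoped ENNReal

namespace PeriodicORP

/-- The space `L²(0,τ;E)`. -/
noncomputable abbrev L2 (τ : ℝ) (E : Type*) [NormedAddCommGroup E] :=
  Lp E 2 (volume.restrict (Ioc (0 : ℝ) τ))

/-- A `τ`-periodic function that is locally square integrable. By periodicity it suffices to
ask for square integrability over one period. -/
def IsPeriodicSignal {E : Type*} [NormedAddCommGroup E] (τ : ℝ) (f : ℝ → E) : Prop :=
  Function.Periodic f τ ∧ MemLp f 2 (volume.restrict (Ioc (0 : ℝ) τ))

/-- A `τ`-periodic system `x' = A(t) x + B(t) u + B_d(t) w`, `y = C(t) x + D(t) u` under the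
standing assumptions: `evol t s` is the strongly continuous `τ`-periodic evolution family
`U_A(t,s)`, `t ≥ s`, through which `A(·)` enters the mild state (the values for `t < s` are
irrelevant), and the other parameters are `τ`-periodic and essentially bounded. -/
structure PeriodicSystem (τ : ℝ) (X U₀ Ud₀ Y₀ : Type*)
    [NormedAddCommGroup X] [NormedSpace ℂ X]
    [NormedAddCommGroup U₀] [NormedSpace ℂ U₀]
    [NormedAddCommGroup Ud₀] [NormedSpace ℂ Ud₀]
    [NormedAddCommGroup Y₀] [NormedSpace ℂ Y₀] where
  evol : ℝ → ℝ → X →L[ℂ] X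
  B : ℝ → U₀ →L[ℂ] X
  Bd : ℝ → Ud₀ →L[ℂ] X
  C : ℝ → X →L[ℂ] Y₀
  D : ℝ → U₀ →L[ℂ] Y₀
  period_pos : 0 < τ
  evol_self : ∀ t, evol t t = ContinuousLinearMap.id ℂ X
  evol_comp : ∀ s r t, s ≤ r → r ≤ t → (evol t r).comp (evol r s) = evol t s
  evol_continuousOn : ∀ x : X, ContinuousOn (fun p : ℝ × ℝ => evol p.1 p.2 x) {p | p.2 ≤ p.1}
  evol_periodic : ∀ s t, s ≤ t → evol (t + τ) (s + τ) = evol t s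
  B_periodic : Function.Periodic B τ
  Bd_periodic : Function.Periodic Bd τ
  C_periodic : Function.Periodic C τ
  D_periodic : Function.Periodic D τ
  B_memLp : MemLp B ∞ volume
  Bd_memLp : MemLp Bd ∞ volume
  C_memLp : MemLp C ∞ volume
  D_memLp : MemLp D ∞ volume

/-- The parameters `(G₁, G₂, K)` of the discrete-time error feedback controller
`z_{n+1} = G₁ z_n + G₂ (y(nτ+·) - y_ref)`, `u(nτ+·) = K z_n`, with state space `Z`. -/
structure Controller (τ : ℝ) (U₀ Y₀ Z : Type*)
    [NormedAddCommGroup U₀] [NormedSpace ℂ U₀]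
    [NormedAddCommGroup Y₀] [NormedSpace ℂ Y₀]
    [NormedAddCommGroup Z] [NormedSpace ℂ Z] where
  G₁ : Z →L[ℂ] Z
  G₂ : L2 τ Y₀ →L[ℂ] Z
  K : Z →L[ℂ] L2 τ U₀

/-- The control input generated by the controller states `z`: on `[nτ, (n+1)τ)` it is
`t ↦ (K z_n)(t - nτ)`. -/
noncomputable def Controller.input {τ : ℝ} {U₀ Y₀ Z : Type*}
    [NormedAddCommGroup U₀] [NormedSpace ℂ U₀]
    [NormedAddCommGroup Y₀] [NormedSpace ℂ Y₀]
    [NormedAddCommGroup Z] [NormedSpace ℂ Z]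
    (c : Controller τ U₀ Y₀ Z) (z : ℕ → Z) (t : ℝ) : U₀ :=
  c.K (z ⌊t / τ⌋₊) (t - ⌊t / τ⌋₊ * τ)

/-- The disturbance `∑ₖ vₖ wₖ(·)`. -/
noncomputable def disturbance {Ud₀ : Type*} [NormedAddCommGroup Ud₀] [NormedSpace ℂ Ud₀] {q : ℕ}
    (w : Fin q → ℝ → Ud₀) (v : EuclideanSpace ℂ (Fin q)) (t : ℝ) : Ud₀ :=
  ∑ k, v k • w k t

namespace PeriodicSystem

variable {τ : ℝ} {X U₀ Ud₀ Y₀ Z : Type*}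
  [NormedAddCommGroup X] [NormedSpace ℂ X]
  [NormedAddCommGroup U₀] [NormedSpace ℂ U₀]
  [NormedAddCommGroup Ud₀] [NormedSpace ℂ Ud₀]
  [NormedAddCommGroup Y₀] [NormedSpace ℂ Y₀]
  [NormedAddCommGroup Z] [NormedSpace ℂ Z]

/-- Exponential stability of the evolution family. -/
def ExpStable (S : PeriodicSystem τ X U₀ Ud₀ Y₀) : Prop :=
  ∃ M > 0, ∃ ω > 0, ∀ s t : ℝ, s ≤ t → ‖S.evol t s‖ ≤ M * Real.exp (-ω * (t - s))

/-- The mild state of the system with initial state `x₀`, input `u` and disturbance `w`. -/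
noncomputable def state (S : PeriodicSystem τ X U₀ Ud₀ Y₀) (x₀ : X) (u : ℝ → U₀) (w : ℝ → Ud₀)
    (t : ℝ) : X :=
  S.evol t 0 x₀ + ∫ s in (0 : ℝ)..t, S.evol t s (S.B s (u s) + S.Bd s (w s))

/-- The output of the system with initial state `x₀`, input `u` and disturbance `w`. -/
noncomputable def output (S : PeriodicSystem τ X U₀ Ud₀ Y₀) (x₀ : X) (u : ℝ → U₀) (w : ℝ → Ud₀)
    (t : ℝ) : Y₀ :=
  S.C t (S.state x₀ u w t) + S.D t (u t)

/-- The kernel `G_A(t,s) = U_A(t,0) (I - U_A(τ,0))⁻¹ U_A(τ,s)`; the inverse exists if the system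
is exponentially stable. -/
noncomputable def periodicKernel (S : PeriodicSystem τ X U₀ Ud₀ Y₀) (t s : ℝ) : X →L[ℂ] X :=
  (S.evol t 0).comp ((Ring.inverse (1 - S.evol τ 0)).comp (S.evol τ s))

/-- The function `𝒫 u = C(·) ∫₀^τ G_A(·,s) B(s) u(s) ds + C(·) ∫₀^· U_A(·,s) B(s) u(s) ds
+ D(·) u(·)`. -/
noncomputable def steadyOutput (S : PeriodicSystem τ X U₀ Ud₀ Y₀) (u : ℝ → U₀) (t : ℝ) : Y₀ :=
  S.C t (∫ s in (0 : ℝ)..τ, S.periodicKernel t s (S.B s (u s))) +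
    S.C t (∫ s in (0 : ℝ)..t, S.evol t s (S.B s (u s))) + S.D t (u t)

/-- `z` is the sequence of controller states in the closed loop of the system and the controller
with initial states `x₀`, `z₀`, reference `yref` and disturbance `w`: for every `n` the regulation
error on the `n`-th period is (the class of) a function `e` in `L²(0,τ;Y₀)`, and
`z_{n+1} = G₁ z_n + G₂ e`. The input, the state and the output of the system are then
`c.input z`, `S.state x₀ (c.input z) w` and `S.output x₀ (c.input z) w`. -/
def IsClosedLoop (S : PeriodicSystem τ X U₀ Ud₀ Y₀) (c : Controller τ U₀ Y₀ Z)
    (yref : ℝ → Y₀) (w : ℝ → Ud₀) (x₀ : X) (z₀ : Z) (z : ℕ → Z) : Prop :=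
  z 0 = z₀ ∧ ∀ n : ℕ, ∃ e : L2 τ Y₀,
    (e =ᵐ[volume.restrict (Ioc (0 : ℝ) τ)]
      fun s => S.output x₀ (c.input z) w (n * τ + s) - yref (n * τ + s)) ∧
    z (n + 1) = c.G₁ (z n) + c.G₂ e

/-- Exponential closed-loop stability (for zero reference and disturbance signals). -/
def ClosedLoopExpStable (S : PeriodicSystem τ X U₀ Ud₀ Y₀) (c : Controller τ U₀ Y₀ Z) : Prop :=
  ∃ M₀ > 0, ∃ M₁ > 0, ∃ α₀ > 0, ∃ α₁ > 0, ∀ (x₀ : X) (z₀ : Z) (z : ℕ → Z),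
    S.IsClosedLoop c 0 0 x₀ z₀ z →
      (∀ t : ℝ, 0 ≤ t →
        ‖S.state x₀ (c.input z) 0 t‖ ≤ M₀ * Real.exp (-α₀ * t) * (‖x₀‖ + ‖z₀‖)) ∧
      ∀ n : ℕ, ‖z n‖ ≤ M₁ * Real.exp (-α₁ * n) * (‖x₀‖ + ‖z₀‖)

/-- The output converges to the reference signal `yref` at a uniform exponential rate, for all
initial states and all disturbances `∑ₖ vₖ wₖ(·)`. -/
def Regulates (S : PeriodicSystem τ X U₀ Ud₀ Y₀) (c : Controller τ U₀ Y₀ Z)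
    (yref : ℝ → Y₀) {q : ℕ} (w : Fin q → ℝ → Ud₀) : Prop :=
  ∃ M > 0, ∃ α > 0, ∀ (x₀ : X) (z₀ : Z) (v : EuclideanSpace ℂ (Fin q)) (z : ℕ → Z),
    S.IsClosedLoop c yref (disturbance w v) x₀ z₀ z → ∀ n : ℕ,
      IntervalIntegrable
        (fun t => ‖S.output x₀ (c.input z) (disturbance w v) t - yref t‖ ^ 2) volume
        (n * τ) ((n + 1) * τ) ∧
      ∫ t in (n * τ)..((n + 1) * τ),
          ‖S.output x₀ (c.input z) (disturbance w v) t - yref t‖ ^ 2 ≤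
        M ^ 2 * Real.exp (-2 * α * n) * (‖x₀‖ ^ 2 + ‖z₀‖ ^ 2 + ‖v‖ ^ 2 + 1)

/-- The controller solves the robust output regulation problem for the system and the signals
`yref`, `∑ₖ vₖ wₖ(·)`: the closed loop is exponentially stable, the output converges to the
reference, and the latter persists for all other periodic signals and for every perturbed system
(under the standing assumptions) with exponentially stable closed loop. -/
def SolvesRobustOutputRegulation (S : PeriodicSystem τ X U₀ Ud₀ Y₀) (c : Controller τ U₀ Y₀ Z)
    (yref : ℝ → Y₀) {q : ℕ} (w : Fin q → ℝ → Ud₀) : Prop :=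
  S.ClosedLoopExpStable c ∧ S.Regulates c yref w ∧
    ∀ S' : PeriodicSystem τ X U₀ Ud₀ Y₀, S'.ClosedLoopExpStable c →
      ∀ (yref' : ℝ → Y₀) (q' : ℕ) (w' : Fin q' → ℝ → Ud₀),
        IsPeriodicSignal τ yref' → (∀ k, IsPeriodicSignal τ (w' k)) → S'.Regulates c yref' w'

/-! ### Well-definedness -/

section WellDefined

variable (S : PeriodicSystem τ X U₀ Ud₀ Y₀)

theorem evol_bounded [CompleteSpace X] (T : ℝ) :
    ∃ M : ℝ, 0 ≤ M ∧ ∀ s t, 0 ≤ s → s ≤ t → t ≤ T → ‖S.evol t s‖ ≤ M := by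
  set K : Set (ℝ × ℝ) := (Icc 0 T ×ˢ Icc 0 T) ∩ {p | p.2 ≤ p.1} with hK
  have hKc : IsCompact K :=
    (isCompact_Icc.prod isCompact_Icc).inter_right (isClosed_le continuous_snd continuous_fst)
  obtain ⟨M, hM⟩ := banach_steinhaus (g := fun p : K => S.evol p.1.1 p.1.2) (by
    intro x
    have h := hKc.image_of_continuousOn ((S.evol_continuousOn x).mono inter_subset_right)
    obtain ⟨M, hM⟩ := h.isBounded.exists_norm_le
    exact ⟨M, fun p => hM _ ⟨p.1, p.2, rfl⟩⟩)
  refine ⟨max M 0, le_max_right _ _, fun s t hs hst ht => le_trans ?_ (le_max_left _ _)⟩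
  exact hM ⟨(t, s), ⟨⟨⟨hs.trans hst, ht⟩, ⟨hs, hst.trans ht⟩⟩, hst⟩⟩

theorem aestronglyMeasurable_evol [CompleteSpace X] {t : ℝ} (ht : 0 ≤ t) {g : ℝ → X}
    (hg : AEStronglyMeasurable g (volume.restrict (Ioc 0 t))) :
    AEStronglyMeasurable (fun s => S.evol t s (g s)) (volume.restrict (Ioc 0 t)) := by
  obtain ⟨M, hM0, hM⟩ := S.evol_bounded t
  let V : ℝ → X →L[ℂ] X := fun s => S.evol t (max 0 (min s t))
  have hVM : ∀ s, ‖V s‖ ≤ M := fun s =>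
    hM _ _ (le_max_left _ _) (max_le ht (min_le_right _ _)) le_rfl
  have hVc : ∀ x, Continuous fun s => V s x := by
    intro x
    have h : Continuous fun s : ℝ => ((t, max 0 (min s t)) : ℝ × ℝ) := by fun_prop
    exact (S.evol_continuousOn x).comp_continuous h fun s => max_le ht (min_le_right _ _)
  have hjoint : Continuous fun p : ℝ × X => V p.1 p.2 := by
    rw [continuous_iff_continuousAt]
    rintro ⟨s₀, x₀⟩
    have h1 : Tendsto (fun p : ℝ × X => V p.1 (p.2 - x₀)) (𝓝 (s₀, x₀)) (𝓝 0) := by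
      have h3 : Tendsto (fun p : ℝ × X => M * ‖p.2 - x₀‖) (𝓝 (s₀, x₀)) (𝓝 0) := by
        have : Continuous fun p : ℝ × X => M * ‖p.2 - x₀‖ := by fun_prop
        simpa using this.tendsto (s₀, x₀)
      exact squeeze_zero_norm (fun p => (V p.1).le_of_opNorm_le (hVM _) _) h3
    have h2 : Tendsto (fun p : ℝ × X => V p.1 x₀) (𝓝 (s₀, x₀)) (𝓝 (V s₀ x₀)) :=
      ((hVc x₀).comp continuous_fst).tendsto (s₀, x₀)
    have h3 := h1.add h2
    simpa [ContinuousAt] using h3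
  have h := hjoint.comp_aestronglyMeasurable (aestronglyMeasurable_id.prodMk hg)
  refine h.congr ?_
  filter_upwards [ae_restrict_mem measurableSet_Ioc] with s hs
  simp [V, min_eq_left hs.2, max_eq_right hs.1.le]

theorem continuousOn_convolution [CompleteSpace X] {T : ℝ} {g : ℝ → X}
    (hg : IntegrableOn g (Ioc 0 T)) :
    ContinuousOn (fun t => ∫ s in (0 : ℝ)..t, S.evol t s (g s)) (Icc 0 T) := by
  obtain ⟨M, hM0, hM⟩ := S.evol_bounded T
  have key : ∀ t ∈ Icc 0 T, ∫ s in (0 : ℝ)..t, S.evol t s (g s) =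
      ∫ s in Ioc 0 T, (Ioc 0 t).indicator (fun s => S.evol t s (g s)) s := by
    intro t ht
    rw [intervalIntegral.integral_of_le ht.1, setIntegral_indicator measurableSet_Ioc,
      inter_eq_right.2 (Ioc_subset_Ioc_right ht.2)]
  refine ContinuousOn.congr ?_ key
  intro t₀ ht₀
  refine continuousWithinAt_of_dominated (bound := fun s => M * ‖g s‖) ?_ ?_ ?_ ?_
  · filter_upwards [self_mem_nhdsWithin] with t ht
    rw [aestronglyMeasurable_indicator_iff measurableSet_Ioc,
      Measure.restrict_restrict measurableSet_Ioc, inter_eq_left.2 (Ioc_subset_Ioc_right ht.2)]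
    exact S.aestronglyMeasurable_evol ht.1
      (hg.aestronglyMeasurable.mono_measure (Measure.restrict_mono_set _
        (Ioc_subset_Ioc_right ht.2)))
  · filter_upwards [self_mem_nhdsWithin] with t ht
    refine ae_of_all _ fun s => ?_
    by_cases hs : s ∈ Ioc 0 t
    · rw [indicator_of_mem hs]
      exact (S.evol t s).le_of_opNorm_le (hM _ _ hs.1.le hs.2 ht.2) _
    · rw [indicator_of_notMem hs, norm_zero]
      positivity
  · exact hg.norm.const_mul M
  · have hne : ∀ᵐ s ∂(volume.restrict (Ioc 0 T)), s ≠ t₀ :=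
      ae_restrict_of_ae (Measure.ae_ne volume t₀)
    filter_upwards [hne, ae_restrict_mem measurableSet_Ioc] with s hs hsT
    rcases lt_or_gt_of_ne hs with h | h
    · have h1 : ContinuousWithinAt (fun t => S.evol t s (g s)) (Icc 0 T) t₀ := by
        have h2 : ContinuousOn (fun t : ℝ => S.evol t s (g s)) (Ici s) :=
          (S.evol_continuousOn (g s)).comp (f := fun t : ℝ => ((t, s) : ℝ × ℝ))
            (by fun_prop) (fun t ht => ht)
        exact (h2.continuousAt (Ici_mem_nhds h)).continuousWithinAt
      refine h1.congr_of_eventuallyEq ?_ ?_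
      · filter_upwards [mem_nhdsWithin_of_mem_nhds (Ici_mem_nhds h)] with t ht
        exact indicator_of_mem (show s ∈ Ioc 0 t from ⟨hsT.1, ht⟩) _
      · exact indicator_of_mem (show s ∈ Ioc 0 t₀ from ⟨hsT.1, h.le⟩) _
    · refine (continuousWithinAt_const (b := (0 : X))).congr_of_eventuallyEq ?_ ?_
      · filter_upwards [mem_nhdsWithin_of_mem_nhds (Iio_mem_nhds h)] with t ht
        exact indicator_of_notMem (fun hh => absurd hh.2 (not_le.2 ht)) _
      · exact indicator_of_notMem (fun hh => absurd hh.2 (not_le.2 h)) _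

theorem memLp_apply {E F : Type*} [NormedAddCommGroup E] [NormedSpace ℂ E]
    [NormedAddCommGroup F] [NormedSpace ℂ F] {s : Set ℝ} {b : ℝ → E →L[ℂ] F} {f : ℝ → E}
    (hb : MemLp b ∞ volume) (hf : MemLp f 2 (volume.restrict s)) :
    MemLp (fun t => b t (f t)) 2 (volume.restrict s) :=
  (ContinuousLinearMap.id ℂ (E →L[ℂ] F)).memLp_of_bilin 2 (hb.restrict s) hf

theorem memLp_of_continuousOn {E : Type*} [NormedAddCommGroup E] {T : ℝ} {f : ℝ → E}
    (hf : ContinuousOn f (Icc 0 T)) : MemLp f 2 (volume.restrict (Ioc 0 T)) := by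
  obtain ⟨M, hM⟩ := isCompact_Icc.exists_bound_of_continuousOn hf
  refine MemLp.of_bound ?_ M ?_
  · exact (hf.aestronglyMeasurable_of_isCompact isCompact_Icc measurableSet_Icc).mono_measure
      (Measure.restrict_mono_set _ Ioc_subset_Icc_self)
  · filter_upwards [ae_restrict_mem measurableSet_Ioc] with t ht
    exact hM t (Ioc_subset_Icc_self ht)

theorem continuousOn_evol_apply (T : ℝ) (x : X) :
    ContinuousOn (fun t => S.evol t 0 x) (Icc 0 T) :=
  (S.evol_continuousOn x).comp (f := fun t : ℝ => ((t, 0) : ℝ × ℝ)) (by fun_prop)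
    (fun _ ht => ht.1)

theorem memLp_output [CompleteSpace X] {T : ℝ} (x₀ : X) {u : ℝ → U₀} {w : ℝ → Ud₀}
    (hu : MemLp u 2 (volume.restrict (Ioc 0 T))) (hw : MemLp w 2 (volume.restrict (Ioc 0 T))) :
    MemLp (S.output x₀ u w) 2 (volume.restrict (Ioc 0 T)) := by
  have h1 : MemLp (fun s => S.B s (u s) + S.Bd s (w s)) 2 (volume.restrict (Ioc 0 T)) :=
    (memLp_apply S.B_memLp hu).add (memLp_apply S.Bd_memLp hw)
  have h2 := S.continuousOn_convolution (T := T) (h1.integrable (by norm_num))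
  exact (memLp_apply S.C_memLp (memLp_of_continuousOn
    ((S.continuousOn_evol_apply T x₀).add h2))).add (memLp_apply S.D_memLp hu)

theorem exists_clm_of_bound {E F : Type*} [NormedAddCommGroup E] [NormedSpace ℂ E]
    [NormedAddCommGroup F] [NormedSpace ℂ F] {τ : ℝ} (T : L2 τ E → ℝ → F)
    (hm : ∀ u, AEStronglyMeasurable (T u) (volume.restrict (Ioc 0 τ)))
    (hadd : ∀ u v, T (u + v) =ᵐ[volume.restrict (Ioc 0 τ)] T u + T v)
    (hsmul : ∀ (a : ℂ) u, T (a • u) =ᵐ[volume.restrict (Ioc 0 τ)] a • T u)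
    (k : ℝ) (hk : 0 ≤ k)
    (hb : ∀ u, ∀ᵐ t ∂(volume.restrict (Ioc 0 τ)), ‖T u t‖ ≤ k * (‖u‖ + ‖u t‖)) :
    ∃ P : L2 τ E →L[ℂ] L2 τ F, ∀ u, P u =ᵐ[volume.restrict (Ioc 0 τ)] T u := by
  set μ := volume.restrict (Ioc (0 : ℝ) τ) with hμ
  have hc : ∀ a : ℝ, MemLp (fun _ : ℝ => a) 2 μ := fun a => memLp_const a
  have hn : ∀ u : L2 τ E, MemLp (fun t => ‖u t‖) 2 μ := fun u => (Lp.memLp u).norm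
  have hmem : ∀ u, MemLp (T u) 2 μ := fun u =>
    MemLp.of_le_mul (c := k) ((hc ‖u‖).add (hn u)) (hm u) (by
      filter_upwards [hb u] with t ht
      refine ht.trans (mul_le_mul_of_nonneg_left ?_ hk)
      exact le_abs_self _)
  let L : L2 τ E →ₗ[ℂ] L2 τ F :=
    { toFun := fun u => (hmem u).toLp
      map_add' := fun u v => by
        rw [← MemLp.toLp_add (hmem u) (hmem v)]
        exact MemLp.toLp_congr _ _ (hadd u v)
      map_smul' := fun a u => by
        rw [RingHom.id_apply, ← MemLp.toLp_const_smul a (hmem u)]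
        exact MemLp.toLp_congr _ _ (hsmul a u) }
  let N : ℝ := ‖(hc 1).toLp‖
  have hL : ∀ u, ‖L u‖ ≤ k * (N + 1) * ‖u‖ := by
    intro u
    set h : Lp ℝ 2 μ := ‖u‖ • (hc 1).toLp + (hn u).toLp with hh
    have h1 : ‖L u‖ ≤ k * ‖h‖ := by
      refine Lp.norm_le_mul_norm_of_ae_le_mul ?_
      filter_upwards [hb u, (hmem u).coeFn_toLp, Lp.coeFn_add (‖u‖ • (hc 1).toLp) (hn u).toLp,
        Lp.coeFn_smul ‖u‖ (hc 1).toLp, (hc 1).coeFn_toLp, (hn u).coeFn_toLp]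
        with t h1 h2 h3 h4 h5 h6
      have h7 : h t = ‖u‖ + ‖u t‖ := by
        rw [hh, h3, Pi.add_apply, h4, Pi.smul_apply, h5, h6, smul_eq_mul, mul_one]
      have h8 : L u t = T u t := h2
      rw [h7, h8]
      exact h1.trans (mul_le_mul_of_nonneg_left (le_abs_self _) hk)
    have h2 : ‖(hn u).toLp‖ ≤ ‖u‖ := by
      refine Lp.norm_le_norm_of_ae_le ?_
      filter_upwards [(hn u).coeFn_toLp] with t ht
      rw [ht, norm_norm]
    have h3 : ‖h‖ ≤ ‖u‖ * N + ‖u‖ := by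
      refine (norm_add_le _ _).trans (add_le_add ?_ h2)
      rw [norm_smul, norm_norm]
    calc ‖L u‖ ≤ k * ‖h‖ := h1
      _ ≤ k * (‖u‖ * N + ‖u‖) := mul_le_mul_of_nonneg_left h3 hk
      _ = k * (N + 1) * ‖u‖ := by ring
  exact ⟨L.mkContinuous _ hL, fun u => (hmem u).coeFn_toLp⟩

theorem exists_bound_of_memLp_top {E : Type*} [NormedAddCommGroup E] {b : ℝ → E}
    (hb : MemLp b ∞ volume) : ∃ β : ℝ, 0 ≤ β ∧ ∀ s : Set ℝ,
      ∀ᵐ t ∂(volume.restrict s), ‖b t‖ ≤ β := by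
  have hfin : eLpNormEssSup b volume ≠ ∞ := by
    rw [← eLpNorm_exponent_top]
    exact hb.eLpNorm_ne_top
  refine ⟨(eLpNormEssSup b volume).toReal, ENNReal.toReal_nonneg, fun s => ?_⟩
  refine ae_restrict_of_ae ?_
  filter_upwards [ae_le_eLpNormEssSup (f := b) (μ := volume)] with t ht
  rw [← toReal_enorm]
  exact ENNReal.toReal_mono hfin ht

theorem exists_steadyOutput_clm [CompleteSpace X] :
    ∃ P : L2 τ U₀ →L[ℂ] L2 τ Y₀,
      ∀ u, P u =ᵐ[volume.restrict (Ioc 0 τ)] S.steadyOutput u := by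
  have hτ := S.period_pos
  set μ := volume.restrict (Ioc (0 : ℝ) τ) with hμ
  set R := Ring.inverse (1 - S.evol τ 0) with hR
  obtain ⟨M, hM0, hM⟩ := S.evol_bounded τ
  obtain ⟨β, hβ0, hβ⟩ := exists_bound_of_memLp_top S.B_memLp
  obtain ⟨γ, hγ0, hγ⟩ := exists_bound_of_memLp_top S.C_memLp
  obtain ⟨δ, hδ0, hδ⟩ := exists_bound_of_memLp_top S.D_memLp
  have hBu : ∀ u : L2 τ U₀, MemLp (fun s => S.B s (u s)) 2 μ := fun u =>
    memLp_apply S.B_memLp (Lp.memLp u)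
  have hBi : ∀ u : L2 τ U₀, Integrable (fun s => S.B s (u s)) μ := fun u =>
    (hBu u).integrable (by norm_num)
  -- integrability of the integrands
  have hI : ∀ (u : L2 τ U₀) (t : ℝ), t ∈ Icc 0 τ →
      IntegrableOn (fun s => S.evol t s (S.B s (u s))) (Ioc 0 t) := by
    intro u t ht
    have hsub : Ioc 0 t ⊆ Ioc 0 τ := Ioc_subset_Ioc_right ht.2
    have hBt : IntegrableOn (fun s => S.B s (u s)) (Ioc 0 t) :=
      IntegrableOn.mono_set (hBi u) hsub
    refine (hBt.norm.const_mul M).mono' (S.aestronglyMeasurable_evol ht.1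
      hBt.aestronglyMeasurable) ?_
    filter_upwards [ae_restrict_mem measurableSet_Ioc] with s hs
    exact (S.evol t s).le_of_opNorm_le (hM _ _ hs.1.le hs.2 ht.2) _
  have hI' : ∀ (u : L2 τ U₀) (t : ℝ), t ∈ Icc 0 τ →
      IntervalIntegrable (fun s => S.evol t s (S.B s (u s))) volume 0 t := fun u t ht =>
    (intervalIntegrable_iff_integrableOn_Ioc_of_le ht.1).2 (hI u t ht)
  -- the convolution term and its value at the end of the period
  let v : L2 τ U₀ → ℝ → X := fun u t => ∫ s in (0 : ℝ)..t, S.evol t s (S.B s (u s))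
  have hker : ∀ (u : L2 τ U₀) (t : ℝ),
      ∫ s in (0 : ℝ)..τ, S.periodicKernel t s (S.B s (u s)) = S.evol t 0 (R (v u τ)) := by
    intro u t
    have h := ((S.evol t 0).comp R).intervalIntegral_comp_comm
      (hI' u τ ⟨hτ.le, le_rfl⟩)
    simpa [periodicKernel, v] using h
  have hT : ∀ (u : L2 τ U₀) (t : ℝ), S.steadyOutput u t =
      S.C t (S.evol t 0 (R (v u τ))) + S.C t (v u t) + S.D t (u t) := by
    intro u t
    rw [steadyOutput, hker]
  have hsub0 : ∀ t ∈ Icc 0 τ, Ioc 0 t ⊆ Ioc 0 τ := fun t ht => Ioc_subset_Ioc_right ht.2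
  have hae : ∀ {p : ℝ → Prop}, (∀ᵐ s ∂μ, p s) → ∀ t ∈ Icc 0 τ,
      ∀ᵐ s ∂(volume.restrict (Ioc 0 t)), p s := fun hp t ht =>
    ae_mono (Measure.restrict_mono_set _ (hsub0 t ht)) hp
  have hvadd : ∀ u u' : L2 τ U₀, ∀ t ∈ Icc 0 τ, v (u + u') t = v u t + v u' t := by
    intro u u' t ht
    simp only [v]
    rw [← intervalIntegral.integral_add (hI' u t ht) (hI' u' t ht),
      intervalIntegral.integral_of_le ht.1, intervalIntegral.integral_of_le ht.1]
    refine integral_congr_ae ?_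
    filter_upwards [hae (Lp.coeFn_add u u') t ht] with s hs
    rw [hs, Pi.add_apply, map_add, map_add]
  have hvsmul : ∀ (a : ℂ) (u : L2 τ U₀), ∀ t ∈ Icc 0 τ, v (a • u) t = a • v u t := by
    intro a u t ht
    simp only [v]
    rw [← intervalIntegral.integral_smul,
      intervalIntegral.integral_of_le ht.1, intervalIntegral.integral_of_le ht.1]
    refine integral_congr_ae ?_
    filter_upwards [hae (Lp.coeFn_smul a u) t ht] with s hs
    rw [hs, Pi.smul_apply, map_smul, map_smul]
  -- the bound for the convolution term
  let N : ℝ := ‖(memLp_const (1 : ℝ) : MemLp (fun _ : ℝ => (1 : ℝ)) 2 μ).toLp‖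
  have hL1 : ∀ u : L2 τ U₀, ∫ s, ‖u s‖ ∂μ ≤ N * ‖u‖ := by
    intro u
    have hn : MemLp (fun t => ‖u t‖) 2 μ := (Lp.memLp u).norm
    have hc : MemLp (fun _ : ℝ => (1 : ℝ)) 2 μ := memLp_const 1
    have h1 : inner ℝ hc.toLp hn.toLp = ∫ s, ‖u s‖ ∂μ := by
      rw [L2.inner_def]
      refine integral_congr_ae ?_
      filter_upwards [hc.coeFn_toLp, hn.coeFn_toLp] with s h1 h2
      rw [h1, h2]
      simp
    rw [← h1]
    refine (real_inner_le_norm _ _).trans (mul_le_mul_of_nonneg_left ?_ (norm_nonneg _))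
    refine Lp.norm_le_norm_of_ae_le ?_
    filter_upwards [hn.coeFn_toLp] with t ht
    rw [ht, norm_norm]
  have hui : ∀ u : L2 τ U₀, Integrable (fun s => ‖u s‖) μ := fun u =>
    ((Lp.memLp u).integrable (by norm_num)).norm
  have hvb : ∀ u : L2 τ U₀, ∀ t ∈ Icc 0 τ, ‖v u t‖ ≤ M * β * N * ‖u‖ := by
    intro u t ht
    simp only [v]
    rw [intervalIntegral.integral_of_le ht.1]
    calc ‖∫ s in Ioc 0 t, S.evol t s (S.B s (u s))‖
        ≤ ∫ s in Ioc 0 t, M * β * ‖u s‖ := by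
          refine norm_integral_le_of_norm_le
            ((IntegrableOn.mono_set (hui u) (hsub0 t ht)).const_mul _) ?_
          filter_upwards [ae_restrict_mem measurableSet_Ioc, hβ (Ioc 0 t)] with s hs hs'
          calc ‖S.evol t s (S.B s (u s))‖ ≤ M * ‖S.B s (u s)‖ :=
                (S.evol t s).le_of_opNorm_le (hM _ _ hs.1.le hs.2 ht.2) _
            _ ≤ M * (β * ‖u s‖) :=
                mul_le_mul_of_nonneg_left ((S.B s).le_of_opNorm_le hs' _) hM0
            _ = M * β * ‖u s‖ := by ring
      _ ≤ ∫ s in Ioc 0 τ, M * β * ‖u s‖ := by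
          refine setIntegral_mono_set ((hui u).const_mul _) (ae_of_all _ fun s => ?_)
            (hsub0 t ht).eventuallyLE
          positivity
      _ = M * β * ∫ s, ‖u s‖ ∂μ := integral_const_mul _ _
      _ ≤ M * β * (N * ‖u‖) := mul_le_mul_of_nonneg_left (hL1 u) (mul_nonneg hM0 hβ0)
      _ = M * β * N * ‖u‖ := by ring
  have hτI : τ ∈ Icc 0 τ := ⟨hτ.le, le_rfl⟩
  set κ := γ * (M * (‖R‖ * (M * β * N))) + γ * (M * β * N) with hκ
  have hN0 : 0 ≤ N := norm_nonneg _
  have hκ0 : 0 ≤ κ := by positivity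
  refine exists_clm_of_bound (fun u => S.steadyOutput u) ?_ ?_ ?_ (κ + δ) (by positivity) ?_
  · intro u
    have h1 : MemLp (fun t => S.C t (S.evol t 0 (R (v u τ)))) 2 μ :=
      memLp_apply S.C_memLp (memLp_of_continuousOn (S.continuousOn_evol_apply τ _))
    have h2 : MemLp (fun t => S.C t (v u t)) 2 μ :=
      memLp_apply S.C_memLp (memLp_of_continuousOn (S.continuousOn_convolution (hBi u)))
    have h3 : MemLp (fun t => S.D t (u t)) 2 μ := memLp_apply S.D_memLp (Lp.memLp u)
    exact ((h1.add h2).add h3).aestronglyMeasurable.congr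
      (ae_of_all _ fun t => (hT u t).symm)
  · intro u u'
    filter_upwards [ae_restrict_mem measurableSet_Ioc, Lp.coeFn_add u u'] with t ht h
    rw [Pi.add_apply, hT, hT, hT, hvadd u u' τ hτI, hvadd u u' t (Ioc_subset_Icc_self ht), h,
      Pi.add_apply]
    simp only [map_add]
    abel
  · intro a u
    filter_upwards [ae_restrict_mem measurableSet_Ioc, Lp.coeFn_smul a u] with t ht h
    rw [Pi.smul_apply, hT, hT, hvsmul a u τ hτI, hvsmul a u t (Ioc_subset_Icc_self ht), h,
      Pi.smul_apply]
    simp only [map_smul, smul_add]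
  · intro u
    filter_upwards [ae_restrict_mem measurableSet_Ioc, hγ (Ioc 0 τ), hδ (Ioc 0 τ)]
      with t ht hC hD
    have ht' := Ioc_subset_Icc_self ht
    rw [hT]
    have h1 : ‖S.C t (S.evol t 0 (R (v u τ)))‖ ≤ γ * (M * (‖R‖ * (M * β * N * ‖u‖))) := by
      refine (S.C t).le_of_opNorm_le_of_le hC ?_
      refine (S.evol t 0).le_of_opNorm_le_of_le (hM _ _ le_rfl ht.1.le ht.2) ?_
      exact R.le_of_opNorm_le_of_le le_rfl (hvb u τ hτI)
    have h2 : ‖S.C t (v u t)‖ ≤ γ * (M * β * N * ‖u‖) :=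
      (S.C t).le_of_opNorm_le_of_le hC (hvb u t ht')
    have h3 : ‖S.D t (u t)‖ ≤ δ * ‖u t‖ := (S.D t).le_of_opNorm_le hD _
    calc _ ≤ γ * (M * (‖R‖ * (M * β * N * ‖u‖))) + γ * (M * β * N * ‖u‖) + δ * ‖u t‖ :=
          norm_add₃_le.trans (add_le_add (add_le_add h1 h2) h3)
      _ = κ * ‖u‖ + δ * ‖u t‖ := by rw [hκ]; ring
      _ ≤ (κ + δ) * (‖u‖ + ‖u t‖) := by
          nlinarith [mul_nonneg hκ0 (norm_nonneg (u t)), mul_nonneg hδ0 (norm_nonneg u)]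

/-- If the system is exponentially stable, then `I - U_A(τ,0)` is boundedly invertible. -/
theorem ExpStable.isUnit_one_sub [CompleteSpace X] {S : PeriodicSystem τ X U₀ Ud₀ Y₀}
    (hS : S.ExpStable) : IsUnit (1 - S.evol τ 0) := by
  obtain ⟨M, hM, ω, hω, h⟩ := hS
  have hτ := S.period_pos
  have hper : ∀ n : ℕ, S.evol (n * τ + τ) (n * τ) = S.evol τ 0 := by
    intro n
    induction n with
    | zero => simp
    | succ n ih =>
      have h1 := S.evol_periodic (n * τ) (n * τ + τ) (by linarith)
      rw [← ih, ← h1]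
      push_cast
      congr 2 <;> ring
  have hpow : ∀ n : ℕ, S.evol τ 0 ^ n = S.evol (n * τ) 0 := by
    intro n
    induction n with
    | zero =>
      rw [pow_zero, Nat.cast_zero, zero_mul, S.evol_self]
      rfl
    | succ n ih =>
      have h0 : (0 : ℝ) ≤ n * τ := by positivity
      have h1 := S.evol_comp 0 (n * τ) (n * τ + τ) h0 (by linarith)
      rw [pow_succ', ih, ← hper n]
      refine h1.trans ?_
      push_cast
      congr 2
      ring
  have hlim : Tendsto (fun n : ℕ => M * Real.exp (-ω * (n * τ - 0))) atTop (𝓝 (M * 0)) := by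
    refine Tendsto.const_mul M (Real.tendsto_exp_atBot.comp ?_)
    have h1 : Tendsto (fun n : ℕ => (ω * τ) * (n : ℝ)) atTop atTop :=
      tendsto_natCast_atTop_atTop.const_mul_atTop (mul_pos hω hτ)
    refine (tendsto_neg_atTop_atBot.comp h1).congr fun n => ?_
    simp only [Function.comp_apply]
    ring
  rw [mul_zero] at hlim
  obtain ⟨n, hn⟩ := (hlim.eventually (gt_mem_nhds one_pos)).exists
  have hlt : ‖S.evol τ 0 ^ n‖ < 1 := by
    rw [hpow]
    exact (h 0 (n * τ) (by positivity)).trans_lt hn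
  have hu : IsUnit (1 - S.evol τ 0 ^ n) := isUnit_one_sub_of_norm_lt_one hlt
  have hc : Commute (1 - S.evol τ 0) (∑ i ∈ Finset.range n, S.evol τ 0 ^ i) :=
    ((Commute.one_left _).sub_left
      (Commute.sum_right _ _ _ fun i _ => Commute.self_pow _ i))
  rw [← mul_neg_geom_sum] at hu
  exact (hc.isUnit_mul_iff.1 hu).1

theorem memLp_translate_iff {E : Type*} [NormedAddCommGroup E] {f : ℝ → E} (a τ : ℝ) :
    MemLp (fun s => f (a + s)) 2 (volume.restrict (Ioc 0 τ)) ↔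
      MemLp f 2 (volume.restrict (Ioc a (a + τ))) := by
  have hmp := (measurePreserving_add_left volume a).restrict_preimage_emb
    (measurableEmbedding_addLeft a) (Ioc a (a + τ))
  have hpre : (fun x => a + x) ⁻¹' Ioc a (a + τ) = Ioc 0 τ := by
    rw [Set.preimage_const_add_Ioc]
    simp
  rw [hpre] at hmp
  rw [← hmp.map_eq, (measurableEmbedding_addLeft a).memLp_map_measure_iff]
  rfl

theorem memLp_of_translates {E : Type*} [NormedAddCommGroup E] {f : ℝ → E} {τ : ℝ} (hτ : 0 < τ)
    (hf : ∀ n : ℕ, MemLp (fun s => f (n * τ + s)) 2 (volume.restrict (Ioc 0 τ))) (n : ℕ) :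
    MemLp f 2 (volume.restrict (Ioc 0 (n * τ))) := by
  induction n with
  | zero => simp
  | succ n ih =>
    have h1 := (memLp_translate_iff (n * τ) τ).1 (hf n)
    have hun : Ioc 0 (n * τ) ∪ Ioc (n * τ) (n * τ + τ) = Ioc 0 (((n + 1 : ℕ) : ℝ) * τ) := by
      rw [Ioc_union_Ioc_eq_Ioc (by positivity) (by linarith)]
      congr 1
      push_cast
      ring
    rw [← hun]
    have hm := (aestronglyMeasurable_union_iff).2
      ⟨ih.aestronglyMeasurable, h1.aestronglyMeasurable⟩
    rw [memLp_two_iff_integrable_sq_norm hm]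
    exact IntegrableOn.union ((memLp_two_iff_integrable_sq_norm ih.aestronglyMeasurable).1 ih)
      ((memLp_two_iff_integrable_sq_norm h1.aestronglyMeasurable).1 h1)

theorem floor_div_eq {τ : ℝ} (hτ : 0 < τ) (n : ℕ) {s : ℝ} (hs : 0 ≤ s) (hs' : s < τ) :
    ⌊(n * τ + s) / τ⌋₊ = n := by
  rw [Nat.floor_eq_iff (by positivity)]
  constructor
  · rw [le_div_iff₀ hτ]
    linarith
  · rw [div_lt_iff₀ hτ]
    linarith

theorem ae_lt_period (τ : ℝ) : ∀ᵐ s ∂(volume.restrict (Ioc (0 : ℝ) τ)), 0 < s ∧ s < τ := by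
  filter_upwards [ae_restrict_mem measurableSet_Ioc,
    ae_restrict_of_ae (Measure.ae_ne volume τ)] with s hs hne
  exact ⟨hs.1, lt_of_le_of_ne hs.2 hne⟩

theorem memLp_input (hτ : 0 < τ) (c : Controller τ U₀ Y₀ Z) (z : ℕ → Z) (n : ℕ) :
    MemLp (c.input z) 2 (volume.restrict (Ioc 0 (n * τ))) := by
  refine memLp_of_translates hτ (fun m => ?_) n
  refine (memLp_congr_ae ?_).2 (Lp.memLp (c.K (z m)))
  filter_upwards [ae_lt_period τ] with s hs
  rw [Controller.input, floor_div_eq hτ m hs.1.le hs.2]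
  congr 1
  ring

theorem _root_.PeriodicORP.IsPeriodicSignal.memLp_shift {E : Type*} [NormedAddCommGroup E]
    {f : ℝ → E} (hf : IsPeriodicSignal τ f) (n : ℕ) :
    MemLp (fun s => f (n * τ + s)) 2 (volume.restrict (Ioc 0 τ)) := by
  have h : (fun s => f (n * τ + s)) = f := by
    funext s
    rw [add_comm]
    exact hf.1.nat_mul n s
  rw [h]
  exact hf.2

/-- The closed-loop regulation error on the `n`-th period is square integrable. -/
theorem memLp_error [CompleteSpace X] (c : Controller τ U₀ Y₀ Z) {yref : ℝ → Y₀} {w : ℝ → Ud₀}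
    (hy : IsPeriodicSignal τ yref) (hw : IsPeriodicSignal τ w) (x₀ : X) (z : ℕ → Z) (n : ℕ) :
    MemLp (fun s => S.output x₀ (c.input z) w (n * τ + s) - yref (n * τ + s)) 2
      (volume.restrict (Ioc 0 τ)) := by
  have hτ := S.period_pos
  refine MemLp.sub ?_ (hy.memLp_shift n)
  rw [memLp_translate_iff (f := S.output x₀ (c.input z) w)]
  have h := S.memLp_output x₀ (memLp_input hτ c z (n + 1))
    (memLp_of_translates hτ hw.memLp_shift (n + 1))
  have hsub : Ioc (n * τ) (n * τ + τ) ⊆ Ioc 0 (((n + 1 : ℕ) : ℝ) * τ) := by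
    refine Ioc_subset_Ioc (by positivity) (le_of_eq ?_)
    push_cast
    ring
  exact h.mono_measure (Measure.restrict_mono_set _ hsub)

theorem isPeriodicSignal_disturbance {q : ℕ} {w : Fin q → ℝ → Ud₀}
    (hw : ∀ k, IsPeriodicSignal τ (w k)) (v : EuclideanSpace ℂ (Fin q)) :
    IsPeriodicSignal τ (disturbance w v) := by
  refine ⟨fun t => ?_, ?_⟩
  · simp only [disturbance, (hw _).1 t]
  · exact memLp_finsetSum _ fun k _ => (hw k).2.const_smul (v k)

theorem existsUnique_of_causal {Z : Type*} (z₀ : Z) (F : ℕ → (ℕ → Z) → Z)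
    (hF : ∀ n z z', (∀ m ≤ n, z m = z' m) → F n z = F n z') :
    ∃! z : ℕ → Z, z 0 = z₀ ∧ ∀ n, z (n + 1) = F n z := by
  let W : ℕ → ℕ → Z := fun n =>
    Nat.rec (fun _ => z₀) (fun n ζ => Function.update ζ (n + 1) (F n ζ)) n
  have hW : ∀ n, W (n + 1) = Function.update (W n) (n + 1) (F n (W n)) := fun n => rfl
  have hstab : ∀ m n, m ≤ n → W n m = W m m := by
    intro m n hmn
    induction n, hmn using Nat.le_induction with
    | base => rfl
    | succ n hn ih => rw [hW, Function.update_of_ne (by omega), ih]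
  refine ⟨fun n => W n n, ⟨rfl, fun n => ?_⟩, ?_⟩
  · show W (n + 1) (n + 1) = _
    rw [hW, Function.update_self]
    exact hF n _ _ fun m hm => hstab m n hm
  · rintro z ⟨h0, hz⟩
    funext n
    induction n using Nat.strong_induction_on with
    | _ n ih =>
      cases n with
      | zero => exact h0
      | succ n =>
        show z (n + 1) = W (n + 1) (n + 1)
        rw [hz, hW, Function.update_self]
        exact hF n _ _ fun m hm => (ih m (by omega)).trans (hstab m n hm).symm

/-- The closed-loop system has exactly one solution for all initial states and periodic signals. -/
theorem existsUnique_isClosedLoop [CompleteSpace X] (c : Controller τ U₀ Y₀ Z) {yref : ℝ → Y₀}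
    {w : ℝ → Ud₀} (hy : IsPeriodicSignal τ yref) (hw : IsPeriodicSignal τ w) (x₀ : X) (z₀ : Z) :
    ∃! z : ℕ → Z, S.IsClosedLoop c yref w x₀ z₀ z := by
  have hτ := S.period_pos
  let F : ℕ → (ℕ → Z) → Z := fun n z =>
    c.G₁ (z n) + c.G₂ (S.memLp_error c hy hw x₀ z n).toLp
  have hiff : ∀ z : ℕ → Z, S.IsClosedLoop c yref w x₀ z₀ z ↔
      z 0 = z₀ ∧ ∀ n, z (n + 1) = F n z := by
    intro z
    refine and_congr_right fun _ => forall_congr' fun n => ⟨?_, fun h => ?_⟩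
    · rintro ⟨e, he, h⟩
      rw [h]
      show _ = c.G₁ (z n) + c.G₂ _
      congr 2
      exact Lp.ext (he.trans (MemLp.coeFn_toLp _).symm)
    · exact ⟨_, MemLp.coeFn_toLp _, h⟩
  have hF : ∀ n z z', (∀ m ≤ n, z m = z' m) → F n z = F n z' := by
    intro n z z' h
    have hin : ∀ t : ℝ, 0 ≤ t → t < n * τ + τ → c.input z t = c.input z' t := by
      intro t ht0 ht
      have hle : ⌊t / τ⌋₊ ≤ n := by
        rw [← Nat.lt_add_one_iff, Nat.floor_lt (by positivity), div_lt_iff₀ hτ]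
        push_cast
        linarith
      rw [Controller.input, Controller.input, h _ hle]
    simp only [F, h n le_rfl]
    congr 2
    refine MemLp.toLp_congr _ _ ?_
    filter_upwards [ae_lt_period τ] with s hs
    have h0 : (0 : ℝ) ≤ n * τ + s := add_nonneg (by positivity) hs.1.le
    have hst : S.state x₀ (c.input z) w (n * τ + s) = S.state x₀ (c.input z') w (n * τ + s) := by
      rw [state, state]
      congr 1
      rw [intervalIntegral.integral_of_le h0, intervalIntegral.integral_of_le h0]
      refine setIntegral_congr_fun measurableSet_Ioc fun r hr => ?_
      show S.evol _ r (S.B r (c.input z r) + _) = S.evol _ r (S.B r (c.input z' r) + _)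
      rw [hin r hr.1.le (by linarith [hr.2, hs.2])]
    rw [output, output, hst, hin _ h0 (by linarith [hs.2])]
  simp only [hiff]
  exact existsUnique_of_causal z₀ F hF


end WellDefined

/-- The operator `𝒫 ∈ L(L²(0,τ;U₀), L²(0,τ;Y₀))`. -/
noncomputable def steadyOperator [CompleteSpace X] (S : PeriodicSystem τ X U₀ Ud₀ Y₀) :
    L2 τ U₀ →L[ℂ] L2 τ Y₀ :=
  S.exists_steadyOutput_clm.choose

theorem steadyOperator_ae_eq [CompleteSpace X] (S : PeriodicSystem τ X U₀ Ud₀ Y₀)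
    (u : L2 τ U₀) :
    S.steadyOperator u =ᵐ[volume.restrict (Ioc (0 : ℝ) τ)] S.steadyOutput u :=
  S.exists_steadyOutput_clm.choose_spec u

end PeriodicSystem

end PeriodicORP

/-! Sampling the state at the times nτ turns the periodic system into a time-invariant discrete-time
system on `X` with input and output spaces `L²(0,τ;U₀)` and `L²(0,τ;Y₀)`: x_{n+1} = T x_n + B u_n,
y_n = C x_n + D u_n, with T = U_A(τ,0), B = `inputOp`, C = `observeOp`, D = `feedOp`. Periodic
signals become constant sequences, and 𝒫 = C(I-T)⁻¹B + D is the transfer function at 1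
(`steadyOperator_eq`).

Regulation is the internal model principle. Since G₁ = I, the controller integrates the error:
z_{n+1} - z_n = G₂ e_n. In the increments of (x_n, z_n) the constant signals cancel, so these
increments form a closed loop with zero signals (`IsClosedLoop.increments`) and decay exponentially
when the closed loop is stable. As G₂ is bounded below, the errors decay too
(`ClosedLoopExpStable.regulates`). Only stability of the closed loop enters, so the same argument
gives robustness.

What remains is stability for all small gains (`exists_low_gain_stable`). With N = G₂C(I-T)⁻¹, the
variable q = z + Nx satisfies q_{n+1} = q_n + εQ z_n, where Q = G₂𝒫K₀. Hence q evolves under I + εQ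
and x under T, with couplings of order ε. The spectral condition makes I + ε₀Q power contractive for
one ε₀ (`exists_norm_one_add_smul_pow_lt_one`); in an adapted norm, convexity yields contraction by
1 - cε for all ε ≤ ε₀. A weighted sum of the two adapted norms then decreases geometrically
(`exists_weighted_contraction`). -/

namespace PeriodicORP

namespace PeriodicSystem

/-! ### Operators on one period from which the discrete-time system is built -/

section Lifting

variable {τ : ℝ} {X U₀ Ud₀ Y₀ Z : Type*}
  [NormedAddCommGroup X] [NormedSpace ℂ X]
  [NormedAddCommGroup U₀] [NormedSpace ℂ U₀]
  [NormedAddCommGroup Ud₀] [NormedSpace ℂ Ud₀]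
  [NormedAddCommGroup Y₀] [NormedSpace ℂ Y₀]
  [NormedAddCommGroup Z] [NormedSpace ℂ Z]

theorem exists_multiplication_clm {E F : Type*} [NormedAddCommGroup E] [NormedSpace ℂ E]
    [NormedAddCommGroup F] [NormedSpace ℂ F] (τ : ℝ) {b : ℝ → E →L[ℂ] F}
    (hb : MemLp b ∞ volume) :
    ∃ P : L2 τ E →L[ℂ] L2 τ F,
      ∀ u, P u =ᵐ[volume.restrict (Ioc 0 τ)] fun t => b t (u t) := by
  obtain ⟨β, hβ0, hβ⟩ := exists_bound_of_memLp_top hb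
  refine exists_clm_of_bound (fun u t => b t (u t)) ?_ ?_ ?_ β hβ0 ?_
  · exact fun u => (memLp_apply hb (Lp.memLp u)).aestronglyMeasurable
  · intro u v
    filter_upwards [Lp.coeFn_add u v] with t h
    rw [h, Pi.add_apply, Pi.add_apply, map_add]
  · intro a u
    filter_upwards [Lp.coeFn_smul a u] with t h
    simp [h]
  · intro u
    filter_upwards [hβ (Ioc 0 τ)] with t h
    refine ((b t).le_of_opNorm_le h _).trans (mul_le_mul_of_nonneg_left ?_ hβ0)
    exact le_add_of_nonneg_left (norm_nonneg u)

/-- Multiplication by an essentially bounded operator-valued function, as an operator on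
`L²(0,τ)`. -/
noncomputable def mulOp {E F : Type*} [NormedAddCommGroup E] [NormedSpace ℂ E]
    [NormedAddCommGroup F] [NormedSpace ℂ F] (τ : ℝ) {b : ℝ → E →L[ℂ] F}
    (hb : MemLp b ∞ volume) : L2 τ E →L[ℂ] L2 τ F :=
  (exists_multiplication_clm τ hb).choose

theorem mulOp_ae_eq {E F : Type*} [NormedAddCommGroup E] [NormedSpace ℂ E]
    [NormedAddCommGroup F] [NormedSpace ℂ F] {b : ℝ → E →L[ℂ] F}
    (hb : MemLp b ∞ volume) (u : L2 τ E) :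
    mulOp τ hb u =ᵐ[volume.restrict (Ioc 0 τ)] fun t => b t (u t) :=
  (exists_multiplication_clm τ hb).choose_spec u

variable (S : PeriodicSystem τ X U₀ Ud₀ Y₀)

/-- The convolution `t ↦ ∫₀ᵗ U_A(t,s) g(s) ds`. -/
noncomputable def convolution (g : ℝ → X) (t : ℝ) : X :=
  ∫ s in (0 : ℝ)..t, S.evol t s (g s)

theorem integrableOn_lp {E : Type*} [NormedAddCommGroup E] (g : L2 τ E) :
    IntegrableOn g (Ioc 0 τ) :=
  (Lp.memLp g).integrable (by norm_num)

theorem intervalIntegrable_evol [CompleteSpace X] {t : ℝ} (ht : 0 ≤ t) {g : ℝ → X}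
    (hg : IntegrableOn g (Ioc 0 t)) :
    IntervalIntegrable (fun s => S.evol t s (g s)) volume 0 t := by
  obtain ⟨M, hM0, hM⟩ := S.evol_bounded t
  refine (intervalIntegrable_iff_integrableOn_Ioc_of_le ht).2 ?_
  refine (hg.norm.const_mul M).mono' (S.aestronglyMeasurable_evol ht hg.aestronglyMeasurable) ?_
  filter_upwards [ae_restrict_mem measurableSet_Ioc] with s hs
  exact (S.evol t s).le_of_opNorm_le (hM _ _ hs.1.le hs.2 le_rfl) _

theorem convolution_congr {g g' : ℝ → X} {t : ℝ} (ht : t ∈ Icc 0 τ)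
    (h : g =ᵐ[volume.restrict (Ioc 0 τ)] g') : S.convolution g t = S.convolution g' t := by
  rw [convolution, convolution, intervalIntegral.integral_of_le ht.1,
    intervalIntegral.integral_of_le ht.1]
  refine integral_congr_ae ?_
  filter_upwards [ae_mono (Measure.restrict_mono_set _ (Ioc_subset_Ioc_right ht.2)) h] with s hs
  rw [hs]

theorem convolution_add [CompleteSpace X] (g g' : L2 τ X) {t : ℝ} (ht : t ∈ Icc 0 τ) :
    S.convolution (g + g' : L2 τ X) t = S.convolution g t + S.convolution g' t := by
  have hsub : Ioc 0 t ⊆ Ioc 0 τ := Ioc_subset_Ioc_right ht.2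
  rw [S.convolution_congr ht (Lp.coeFn_add g g')]
  simp only [convolution, Pi.add_apply, map_add]
  exact intervalIntegral.integral_add
    (S.intervalIntegrable_evol ht.1 ((integrableOn_lp g).mono_set hsub))
    (S.intervalIntegrable_evol ht.1 ((integrableOn_lp g').mono_set hsub))

theorem convolution_smul (a : ℂ) (g : L2 τ X) {t : ℝ} (ht : t ∈ Icc 0 τ) :
    S.convolution (a • g : L2 τ X) t = a • S.convolution g t := by
  rw [S.convolution_congr ht (Lp.coeFn_smul a g)]
  simp only [convolution, Pi.smul_apply, map_smul]
  exact intervalIntegral.integral_smul _ _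

theorem exists_integral_norm_le {E : Type*} [NormedAddCommGroup E] (τ : ℝ) :
    ∃ N : ℝ, 0 ≤ N ∧ ∀ u : L2 τ E, ∫ s in Ioc 0 τ, ‖u s‖ ≤ N * ‖u‖ := by
  have hc : MemLp (fun _ : ℝ => (1 : ℝ)) 2 (volume.restrict (Ioc 0 τ)) := memLp_const 1
  refine ⟨‖hc.toLp‖, norm_nonneg _, fun u => ?_⟩
  have hn : MemLp (fun t => ‖u t‖) 2 (volume.restrict (Ioc 0 τ)) := (Lp.memLp u).norm
  -- Cauchy–Schwarz against the constant function 1, whose `L²` norm is the constant `N`.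
  have h1 : inner ℝ hc.toLp hn.toLp = ∫ s in Ioc 0 τ, ‖u s‖ := by
    rw [L2.inner_def]
    refine integral_congr_ae ?_
    filter_upwards [hc.coeFn_toLp, hn.coeFn_toLp] with s h1 h2
    rw [h1, h2]
    simp
  rw [← h1]
  refine (real_inner_le_norm _ _).trans (mul_le_mul_of_nonneg_left ?_ (norm_nonneg _))
  refine Lp.norm_le_norm_of_ae_le ?_
  filter_upwards [hn.coeFn_toLp] with t ht
  rw [ht, norm_norm]

/-- The bound is pointwise in time, not merely in `L²`: it makes the value at the end of the period
a bounded operator, and later controls the state between sampling times. -/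
theorem exists_convolution_bound [CompleteSpace X] :
    ∃ k : ℝ, 0 ≤ k ∧ ∀ (g : L2 τ X), ∀ t ∈ Icc 0 τ, ‖S.convolution g t‖ ≤ k * ‖g‖ := by
  obtain ⟨M, hM0, hM⟩ := S.evol_bounded τ
  obtain ⟨N, hN0, hN⟩ := exists_integral_norm_le (E := X) τ
  refine ⟨M * N, mul_nonneg hM0 hN0, fun g t ht => ?_⟩
  have hsub : Ioc 0 t ⊆ Ioc 0 τ := Ioc_subset_Ioc_right ht.2
  have hg := (integrableOn_lp g).norm
  rw [convolution, intervalIntegral.integral_of_le ht.1]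
  calc ‖∫ s in Ioc 0 t, S.evol t s (g s)‖ ≤ ∫ s in Ioc 0 t, M * ‖g s‖ := by
        refine norm_integral_le_of_norm_le ((IntegrableOn.mono_set hg hsub).const_mul _) ?_
        filter_upwards [ae_restrict_mem measurableSet_Ioc] with s hs
        exact (S.evol t s).le_of_opNorm_le (hM _ _ hs.1.le hs.2 ht.2) _
    _ ≤ ∫ s in Ioc 0 τ, M * ‖g s‖ :=
        setIntegral_mono_set (hg.const_mul _) (ae_of_all _ fun s => by positivity)
          hsub.eventuallyLE
    _ = M * ∫ s in Ioc 0 τ, ‖g s‖ := integral_const_mul _ _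
    _ ≤ M * (N * ‖g‖) := mul_le_mul_of_nonneg_left (hN g) hM0
    _ = M * N * ‖g‖ := by ring

theorem exists_convolution_clm [CompleteSpace X] :
    ∃ P : L2 τ X →L[ℂ] L2 τ X,
      ∀ g, P g =ᵐ[volume.restrict (Ioc 0 τ)] S.convolution g := by
  obtain ⟨k, hk0, hk⟩ := S.exists_convolution_bound
  refine exists_clm_of_bound (fun g => S.convolution g) ?_ ?_ ?_ k hk0 ?_
  · exact fun g => (memLp_of_continuousOn
      (S.continuousOn_convolution (integrableOn_lp g))).aestronglyMeasurable
  · intro g g'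
    filter_upwards [ae_restrict_mem measurableSet_Ioc] with t ht
    exact S.convolution_add g g' (Ioc_subset_Icc_self ht)
  · intro a g
    filter_upwards [ae_restrict_mem measurableSet_Ioc] with t ht
    exact S.convolution_smul a g (Ioc_subset_Icc_self ht)
  · intro g
    filter_upwards [ae_restrict_mem measurableSet_Ioc] with t ht
    refine (hk g t (Ioc_subset_Icc_self ht)).trans (mul_le_mul_of_nonneg_left ?_ hk0)
    exact le_add_of_nonneg_right (norm_nonneg _)

/-- The convolution with the evolution family as an operator on `L²(0,τ;X)`. -/
noncomputable def convOp [CompleteSpace X] : L2 τ X →L[ℂ] L2 τ X :=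
  S.exists_convolution_clm.choose

theorem convOp_ae_eq [CompleteSpace X] (g : L2 τ X) :
    S.convOp g =ᵐ[volume.restrict (Ioc 0 τ)] S.convolution g :=
  S.exists_convolution_clm.choose_spec g

theorem exists_endpoint_clm [CompleteSpace X] :
    ∃ P : L2 τ X →L[ℂ] X, ∀ g, P g = S.convolution g τ := by
  obtain ⟨k, hk0, hk⟩ := S.exists_convolution_bound
  have hτ : τ ∈ Icc 0 τ := ⟨S.period_pos.le, le_rfl⟩
  let L : L2 τ X →ₗ[ℂ] X :=
    { toFun := fun g => S.convolution g τ
      map_add' := fun g g' => S.convolution_add g g' hτ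
      map_smul' := fun a g => S.convolution_smul a g hτ }
  exact ⟨L.mkContinuous k fun g => hk g τ hτ, fun g => rfl⟩

/-- The operator `g ↦ ∫₀^τ U_A(τ,s) g(s) ds`. -/
noncomputable def endOp [CompleteSpace X] : L2 τ X →L[ℂ] X :=
  S.exists_endpoint_clm.choose

theorem endOp_eq [CompleteSpace X] (g : L2 τ X) : S.endOp g = S.convolution g τ :=
  S.exists_endpoint_clm.choose_spec g

theorem exists_free_clm [CompleteSpace X] :
    ∃ P : X →L[ℂ] L2 τ X,
      ∀ x, P x =ᵐ[volume.restrict (Ioc 0 τ)] fun t => S.evol t 0 x := by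
  obtain ⟨M, hM0, hM⟩ := S.evol_bounded τ
  have hmem : ∀ x, MemLp (fun t => S.evol t 0 x) 2 (volume.restrict (Ioc 0 τ)) := fun x =>
    memLp_of_continuousOn (S.continuousOn_evol_apply τ x)
  have hc : MemLp (fun _ : ℝ => (1 : ℝ)) 2 (volume.restrict (Ioc 0 τ)) := memLp_const 1
  let L : X →ₗ[ℂ] L2 τ X :=
    { toFun := fun x => (hmem x).toLp
      map_add' := fun x y => by
        rw [← MemLp.toLp_add (hmem x) (hmem y)]
        exact MemLp.toLp_congr _ _ (ae_of_all _ fun t => by simp)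
      map_smul' := fun a x => by
        rw [RingHom.id_apply, ← MemLp.toLp_const_smul a (hmem x)]
        exact MemLp.toLp_congr _ _ (ae_of_all _ fun t => by simp) }
  have hL : ∀ x, ‖L x‖ ≤ M * ‖hc.toLp‖ * ‖x‖ := by
    intro x
    have h : ‖L x‖ ≤ (M * ‖x‖) * ‖hc.toLp‖ := by
      refine Lp.norm_le_mul_norm_of_ae_le_mul ?_
      filter_upwards [(hmem x).coeFn_toLp, hc.coeFn_toLp, ae_restrict_mem measurableSet_Ioc]
        with t h1 h2 h3
      have h4 : L x t = S.evol t 0 x := h1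
      rw [h4, h2, norm_one, mul_one]
      exact (S.evol t 0).le_of_opNorm_le (hM _ _ le_rfl h3.1.le h3.2) _
    exact h.trans (le_of_eq (by ring))
  exact ⟨L.mkContinuous _ hL, fun x => (hmem x).coeFn_toLp⟩

/-- The free motion `x ↦ U_A(·,0) x` as an operator from `X` to `L²(0,τ;X)`. -/
noncomputable def freeOp [CompleteSpace X] : X →L[ℂ] L2 τ X :=
  S.exists_free_clm.choose

theorem freeOp_ae_eq [CompleteSpace X] (x : X) :
    S.freeOp x =ᵐ[volume.restrict (Ioc 0 τ)] fun t => S.evol t 0 x :=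
  S.exists_free_clm.choose_spec x

/-! ### Shifting time by whole periods -/

theorem evol_shift (n : ℕ) {s t : ℝ} (h : s ≤ t) :
    S.evol (n * τ + t) (n * τ + s) = S.evol t s := by
  induction n with
  | zero => simp
  | succ n ih =>
    rw [← ih, ← S.evol_periodic (n * τ + s) (n * τ + t) (by linarith)]
    push_cast
    congr 1 <;> ring

/-- Split the integral at nτ. On the past part the evolution factors through time nτ; on the recent
part periodicity removes the shift. -/
theorem convolution_shift [CompleteSpace X] (n : ℕ) {s : ℝ} (hs : 0 ≤ s) {g : ℝ → X}
    (hg : IntegrableOn g (Ioc 0 (n * τ + s))) :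
    S.convolution g (n * τ + s) =
      S.evol s 0 (S.convolution g (n * τ)) + S.convolution (fun r => g (n * τ + r)) s := by
  have hτ := S.period_pos
  have ha : (0 : ℝ) ≤ n * τ := by positivity
  have hI := S.intervalIntegrable_evol (add_nonneg ha hs) hg
  have hm : n * τ ∈ uIcc 0 (n * τ + s) := by
    rw [uIcc_of_le (by linarith)]
    exact ⟨ha, by linarith⟩
  rw [convolution, ← intervalIntegral.integral_add_adjacent_intervals
    (hI.mono_set (uIcc_subset_uIcc_left hm)) (hI.mono_set (uIcc_subset_uIcc_right hm))]
  congr 1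
  · rw [convolution, ← (S.evol s 0).intervalIntegral_comp_comm (S.intervalIntegrable_evol ha
      (hg.mono_set (Ioc_subset_Ioc_right (by linarith))))]
    refine intervalIntegral.integral_congr fun r hr => ?_
    rw [uIcc_of_le ha] at hr
    have h1 := S.evol_comp r (n * τ) (n * τ + s) hr.2 (by linarith)
    have h2 := S.evol_shift n hs
    rw [add_zero] at h2
    show S.evol (n * τ + s) r (g r) = S.evol s 0 (S.evol (n * τ) r (g r))
    rw [← h1, h2]
    rfl
  · have h := intervalIntegral.integral_comp_add_left (a := 0) (b := s)
      (fun r => S.evol (n * τ + s) r (g r)) (n * τ)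
    rw [add_zero] at h
    rw [← h, convolution]
    refine intervalIntegral.integral_congr fun r hr => ?_
    rw [uIcc_of_le hs] at hr
    show S.evol (n * τ + s) (n * τ + r) _ = _
    rw [S.evol_shift n hr.2]

theorem state_eq_convolution (x₀ : X) (u : ℝ → U₀) (w : ℝ → Ud₀) (t : ℝ) :
    S.state x₀ u w t = S.evol t 0 x₀ + S.convolution (fun s => S.B s (u s) + S.Bd s (w s)) t :=
  rfl

theorem state_zero (x₀ : X) (u : ℝ → U₀) (w : ℝ → Ud₀) : S.state x₀ u w 0 = x₀ := by
  simp [state, S.evol_self]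

/-- A periodic system restarted at time nτ is the same system; this is what makes the sampled system
time-invariant. -/
theorem state_shift [CompleteSpace X] (n : ℕ) {s : ℝ} (hs : 0 ≤ s) (x₀ : X) {u : ℝ → U₀}
    {w : ℝ → Ud₀} (hu : MemLp u 2 (volume.restrict (Ioc 0 (n * τ + s))))
    (hw : MemLp w 2 (volume.restrict (Ioc 0 (n * τ + s)))) :
    S.state x₀ u w (n * τ + s) =
      S.state (S.state x₀ u w (n * τ)) (fun r => u (n * τ + r)) (fun r => w (n * τ + r)) s := by
  have hτ := S.period_pos
  have ha : (0 : ℝ) ≤ n * τ := by positivity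
  have hg := ((memLp_apply S.B_memLp hu).add (memLp_apply S.Bd_memLp hw)).integrable
    (by norm_num)
  have h1 := S.evol_comp 0 (n * τ) (n * τ + s) ha (by linarith)
  have h2 := S.evol_shift n hs
  rw [add_zero] at h2
  have hB : ∀ r, S.B (n * τ + r) = S.B r := fun r => by
    rw [add_comm]; exact S.B_periodic.nat_mul n r
  have hBd : ∀ r, S.Bd (n * τ + r) = S.Bd r := fun r => by
    rw [add_comm]; exact S.Bd_periodic.nat_mul n r
  have h3 := S.convolution_shift n hs hg
  simp only [Pi.add_apply, hB, hBd] at h3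
  rw [state_eq_convolution, state_eq_convolution, state_eq_convolution, map_add, ← h1, h2]
  rw [add_assoc]
  congr 1

end Lifting

/-! ### The lifted discrete-time system and its closed loop -/

section DiscreteTime

variable {τ : ℝ} {X U₀ Ud₀ Y₀ Z : Type*}
  [NormedAddCommGroup X] [NormedSpace ℂ X] [CompleteSpace X]
  [NormedAddCommGroup U₀] [NormedSpace ℂ U₀]
  [NormedAddCommGroup Ud₀] [NormedSpace ℂ Ud₀]
  [NormedAddCommGroup Y₀] [NormedSpace ℂ Y₀]
  [NormedAddCommGroup Z] [NormedSpace ℂ Z]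
  (S : PeriodicSystem τ X U₀ Ud₀ Y₀)

/-- The effect of the input over one period on the state at the end of the period. -/
noncomputable def inputOp : L2 τ U₀ →L[ℂ] X :=
  S.endOp.comp (mulOp τ S.B_memLp)

/-- The effect of the state at the beginning of a period on the output over the period. -/
noncomputable def observeOp : X →L[ℂ] L2 τ Y₀ :=
  (mulOp τ S.C_memLp).comp S.freeOp

/-- The effect of the input over one period on the output over the same period. -/
noncomputable def feedOp : L2 τ U₀ →L[ℂ] L2 τ Y₀ :=
  (mulOp τ S.C_memLp).comp (S.convOp.comp (mulOp τ S.B_memLp)) + mulOp τ S.D_memLp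

/-- The effect of the disturbance over one period on the state at the end of the period. -/
noncomputable def disturbStateOp : L2 τ Ud₀ →L[ℂ] X :=
  S.endOp.comp (mulOp τ S.Bd_memLp)

/-- The effect of the disturbance over one period on the output over the same period. -/
noncomputable def disturbOutputOp : L2 τ Ud₀ →L[ℂ] L2 τ Y₀ :=
  (mulOp τ S.C_memLp).comp (S.convOp.comp (mulOp τ S.Bd_memLp))

/-- Repeating the input `u` in every period, the periodic state starts each period at the fixed
point (I - T)⁻¹Bu of x ↦ Tx + Bu. So 𝒫 is the transfer function C(λ - T)⁻¹B + D at λ = 1. -/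
theorem steadyOperator_eq :
    S.steadyOperator =
      S.observeOp.comp ((Ring.inverse (1 - S.evol τ 0)).comp S.inputOp) + S.feedOp := by
  have hτ : τ ∈ Icc 0 τ := ⟨S.period_pos.le, le_rfl⟩
  ext1 u
  refine Lp.ext ?_
  set R := Ring.inverse (1 - S.evol τ 0) with hR
  set g := mulOp τ S.B_memLp u with hg
  have hgu := mulOp_ae_eq S.B_memLp u
  have hconv : ∀ t ∈ Icc 0 τ, ∫ s in (0 : ℝ)..t, S.evol t s (S.B s (u s)) =
      S.convolution g t := fun t ht => (S.convolution_congr ht hgu).symm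
  have hker : ∀ t, ∫ s in (0 : ℝ)..τ, S.periodicKernel t s (S.B s (u s)) =
      S.evol t 0 (R (S.endOp g)) := by
    intro t
    have hi : IntegrableOn (fun s => S.B s (u s)) (Ioc 0 τ) :=
      (memLp_apply S.B_memLp (Lp.memLp u)).integrable (by norm_num)
    have h := ((S.evol t 0).comp R).intervalIntegral_comp_comm
      (S.intervalIntegrable_evol S.period_pos.le hi)
    rw [S.endOp_eq, ← hconv τ hτ]
    simpa [periodicKernel] using h
  have hsum : (S.observeOp.comp (R.comp S.inputOp) + S.feedOp) u =
      mulOp τ S.C_memLp (S.freeOp (R (S.endOp g))) + (mulOp τ S.C_memLp (S.convOp g) +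
        mulOp τ S.D_memLp u) := rfl
  rw [hsum]
  filter_upwards [S.steadyOperator_ae_eq u, ae_restrict_mem measurableSet_Ioc,
    Lp.coeFn_add (mulOp τ S.C_memLp (S.freeOp (R (S.endOp g))))
      (mulOp τ S.C_memLp (S.convOp g) + mulOp τ S.D_memLp u),
    Lp.coeFn_add (mulOp τ S.C_memLp (S.convOp g)) (mulOp τ S.D_memLp u),
    mulOp_ae_eq S.C_memLp (S.freeOp (R (S.endOp g))), mulOp_ae_eq S.C_memLp (S.convOp g),
    mulOp_ae_eq S.D_memLp u, S.freeOp_ae_eq (R (S.endOp g)), S.convOp_ae_eq g]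
    with t h1 h2 h3 h4 h5 h6 h7 h8 h9
  rw [h1, h3, Pi.add_apply, h4, Pi.add_apply, h5, h6, h7, h8, h9, steadyOutput, hker,
    hconv t (Ioc_subset_Icc_self h2), add_assoc]

theorem input_shift (hτ : 0 < τ) (c : Controller τ U₀ Y₀ Z) (z : ℕ → Z) (n : ℕ) {s : ℝ}
    (hs : 0 ≤ s) (hs' : s < τ) : c.input z (n * τ + s) = c.K (z n) s := by
  rw [Controller.input, floor_div_eq hτ n hs hs']
  congr 1
  ring

theorem input_shift_ae (hτ : 0 < τ) (c : Controller τ U₀ Y₀ Z) (z : ℕ → Z) (n : ℕ) :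
    (fun s => c.input z (n * τ + s)) =ᵐ[volume.restrict (Ioc 0 τ)] c.K (z n) := by
  filter_upwards [ae_lt_period τ] with s hs
  exact input_shift hτ c z n hs.1.le hs.2

variable {w : ℝ → Ud₀} {W : L2 τ Ud₀}

theorem _root_.PeriodicORP.IsPeriodicSignal.shift {E : Type*} [NormedAddCommGroup E]
    {f : ℝ → E} (hf : IsPeriodicSignal τ f) (n : ℕ) (s : ℝ) : f (n * τ + s) = f s := by
  rw [add_comm]
  exact hf.1.nat_mul n s

/-- The closed-loop state within the `n`-th period. -/
theorem state_period (c : Controller τ U₀ Y₀ Z) (hw : IsPeriodicSignal τ w)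
    (hW : W =ᵐ[volume.restrict (Ioc 0 τ)] w) (x₀ : X) (z : ℕ → Z) (n : ℕ) {s : ℝ}
    (hs : s ∈ Icc 0 τ) :
    S.state x₀ (c.input z) w (n * τ + s) =
      S.evol s 0 (S.state x₀ (c.input z) w (n * τ)) +
        S.convolution (mulOp τ S.B_memLp (c.K (z n)) + mulOp τ S.Bd_memLp W : L2 τ X) s := by
  have hτ := S.period_pos
  have hsub : Ioc 0 (n * τ + s) ⊆ Ioc 0 (((n + 1 : ℕ) : ℝ) * τ) := by
    refine Ioc_subset_Ioc_right ?_
    push_cast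
    linarith [hs.2]
  rw [S.state_shift n hs.1 x₀
    ((memLp_input hτ c z (n + 1)).mono_measure (Measure.restrict_mono_set _ hsub))
    ((memLp_of_translates hτ hw.memLp_shift (n + 1)).mono_measure
      (Measure.restrict_mono_set _ hsub)), state_eq_convolution]
  congr 1
  -- At `s = τ` the input already belongs to the next period, but the integral sees only almost
  -- every time. The formula therefore includes the endpoint, which yields the recursion for the
  -- samples.
  refine S.convolution_congr hs ?_
  filter_upwards [input_shift_ae hτ c z n, hW, mulOp_ae_eq S.B_memLp (c.K (z n)),
    mulOp_ae_eq S.Bd_memLp W,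
    Lp.coeFn_add (mulOp τ S.B_memLp (c.K (z n))) (mulOp τ S.Bd_memLp W)] with r h1 h2 h3 h4 h5
  rw [h5, Pi.add_apply, h3, h4, h2, h1, hw.shift]

theorem state_succ (c : Controller τ U₀ Y₀ Z) (hw : IsPeriodicSignal τ w)
    (hW : W =ᵐ[volume.restrict (Ioc 0 τ)] w) (x₀ : X) (z : ℕ → Z) (n : ℕ) :
    S.state x₀ (c.input z) w ((n + 1 : ℕ) * τ) =
      S.evol τ 0 (S.state x₀ (c.input z) w (n * τ)) + S.inputOp (c.K (z n)) +
        S.disturbStateOp W := by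
  have h := S.state_period c hw hW x₀ z n ⟨S.period_pos.le, le_rfl⟩
  rw [← S.endOp_eq, map_add, ← add_assoc] at h
  rw [show ((n + 1 : ℕ) : ℝ) * τ = n * τ + τ by push_cast; ring]
  exact h

/-- The closed-loop regulation error on the `n`-th period. -/
theorem error_period (c : Controller τ U₀ Y₀ Z) (hw : IsPeriodicSignal τ w)
    (hW : W =ᵐ[volume.restrict (Ioc 0 τ)] w) {yref : ℝ → Y₀} {V : L2 τ Y₀}
    (hy : IsPeriodicSignal τ yref) (hV : V =ᵐ[volume.restrict (Ioc 0 τ)] yref)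
    (x₀ : X) (z : ℕ → Z) (n : ℕ) :
    (S.observeOp (S.state x₀ (c.input z) w (n * τ)) + S.feedOp (c.K (z n)) +
      S.disturbOutputOp W - V : L2 τ Y₀) =ᵐ[volume.restrict (Ioc 0 τ)]
        fun s => S.output x₀ (c.input z) w (n * τ + s) - yref (n * τ + s) := by
  have hτ := S.period_pos
  have hC : ∀ r, S.C (n * τ + r) = S.C r := fun r => by
    rw [add_comm]; exact S.C_periodic.nat_mul n r
  have hD : ∀ r, S.D (n * τ + r) = S.D r := fun r => by
    rw [add_comm]; exact S.D_periodic.nat_mul n r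
  set x := S.state x₀ (c.input z) w (n * τ) with hx
  set u := c.K (z n) with hu
  set g := mulOp τ S.B_memLp u + mulOp τ S.Bd_memLp W with hg
  -- Free motion and both forced parts are collected so that `C` acts on the full state within the
  -- period.
  have hsum : S.observeOp x + S.feedOp u + S.disturbOutputOp W - V =
      mulOp τ S.C_memLp (S.freeOp x + S.convOp g) + mulOp τ S.D_memLp u - V := by
    simp only [observeOp, feedOp, disturbOutputOp, hg, ContinuousLinearMap.comp_apply,
      add_apply, map_add]
    abel
  rw [hsum]
  filter_upwards [ae_lt_period τ, hV,
    Lp.coeFn_sub (mulOp τ S.C_memLp (S.freeOp x + S.convOp g) + mulOp τ S.D_memLp u) V,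
    Lp.coeFn_add (mulOp τ S.C_memLp (S.freeOp x + S.convOp g)) (mulOp τ S.D_memLp u),
    mulOp_ae_eq S.C_memLp (S.freeOp x + S.convOp g), mulOp_ae_eq S.D_memLp u,
    Lp.coeFn_add (S.freeOp x) (S.convOp g), S.freeOp_ae_eq x, S.convOp_ae_eq g]
    with s h1 h2 h3 h4 h5 h6 h7 h8 h9
  rw [h3, Pi.sub_apply, h4, Pi.add_apply, h5, h6, h7, Pi.add_apply, h8, h9, h2, output,
    S.state_period c hw hW x₀ z n ⟨h1.1.le, h1.2.le⟩, input_shift hτ c z n h1.1.le h1.2,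
    hC, hD, hy.shift]

/-- The error class is determined by its representative almost everywhere, so the closed loop is a
recursion in which the signals enter only through the fixed classes `W` and `V`. -/
theorem isClosedLoop_iff (c : Controller τ U₀ Y₀ Z) (hw : IsPeriodicSignal τ w)
    (hW : W =ᵐ[volume.restrict (Ioc 0 τ)] w) {yref : ℝ → Y₀} {V : L2 τ Y₀}
    (hy : IsPeriodicSignal τ yref) (hV : V =ᵐ[volume.restrict (Ioc 0 τ)] yref)
    (x₀ : X) (z₀ : Z) (z : ℕ → Z) :
    S.IsClosedLoop c yref w x₀ z₀ z ↔ z 0 = z₀ ∧ ∀ n : ℕ, z (n + 1) = c.G₁ (z n) +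
      c.G₂ (S.observeOp (S.state x₀ (c.input z) w (n * τ)) + S.feedOp (c.K (z n)) +
        S.disturbOutputOp W - V) := by
  refine and_congr_right fun _ => forall_congr' fun n => ⟨?_, fun h => ?_⟩
  · rintro ⟨e, he, h⟩
    rw [h, Lp.ext (he.trans (S.error_period c hw hW hy hV x₀ z n).symm)]
  · exact ⟨_, S.error_period c hw hW hy hV x₀ z n, h⟩

theorem _root_.PeriodicORP.isPeriodicSignal_zero {E : Type*} [NormedAddCommGroup E] :
    IsPeriodicSignal τ (0 : ℝ → E) :=
  ⟨fun _ => rfl, MemLp.zero⟩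

/-- Converse of `state_succ`: it identifies a sequence built by hand, such as the increments below,
with the samples of a mild state. -/
theorem state_eq_of_recursion (c : Controller τ U₀ Y₀ Z) (hw : IsPeriodicSignal τ w)
    (hW : W =ᵐ[volume.restrict (Ioc 0 τ)] w) (x : ℕ → X) (z : ℕ → Z)
    (hx : ∀ n, x (n + 1) = S.evol τ 0 (x n) + S.inputOp (c.K (z n)) + S.disturbStateOp W)
    (n : ℕ) : S.state (x 0) (c.input z) w (n * τ) = x n := by
  induction n with
  | zero => rw [Nat.cast_zero, zero_mul, state_zero]
  | succ n ih => rw [S.state_succ c hw hW, ih, hx]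

/-- The increments of the states of a closed loop with periodic signals form a solution of the
homogeneous closed loop. -/
theorem IsClosedLoop.increments {c : Controller τ U₀ Y₀ Z} (hw : IsPeriodicSignal τ w)
    {yref : ℝ → Y₀} (hy : IsPeriodicSignal τ yref) {x₀ : X} {z₀ : Z} {z : ℕ → Z}
    (h : S.IsClosedLoop c yref w x₀ z₀ z) :
    S.IsClosedLoop c 0 0 (S.state x₀ (c.input z) w τ - x₀) (z 1 - z 0)
      (fun n => z (n + 1) - z n) := by
  have hW := hw.2.coeFn_toLp
  have hV := hy.2.coeFn_toLp
  have h0 : (0 : L2 τ Ud₀) =ᵐ[volume.restrict (Ioc 0 τ)] (0 : ℝ → Ud₀) := Lp.coeFn_zero _ _ _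
  have h0' : (0 : L2 τ Y₀) =ᵐ[volume.restrict (Ioc 0 τ)] (0 : ℝ → Y₀) := Lp.coeFn_zero _ _ _
  obtain ⟨-, hz⟩ := (S.isClosedLoop_iff c hw hW hy hV x₀ z₀ z).1 h
  set x : ℕ → X := fun n => S.state x₀ (c.input z) w (n * τ) with hx
  have hxs : ∀ n, x (n + 1) = S.evol τ 0 (x n) + S.inputOp (c.K (z n)) +
      S.disturbStateOp hw.2.toLp := S.state_succ c hw hW x₀ z
  have hx1 : S.state x₀ (c.input z) w τ - x₀ = x 1 - x 0 := by
    simp [hx, state_zero]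
  have key := S.state_eq_of_recursion c (isPeriodicSignal_zero (τ := τ)) h0
    (fun n => x (n + 1) - x n) (fun n => z (n + 1) - z n) (by
      intro n
      -- The disturbance contributes the same vector in every period and cancels in the difference.
      refine (congrArg₂ (· - ·) (hxs (n + 1)) (hxs n)).trans ?_
      simp only [map_sub, map_zero]
      abel)
  rw [hx1, S.isClosedLoop_iff c isPeriodicSignal_zero h0 isPeriodicSignal_zero h0']
  refine ⟨rfl, fun n => ?_⟩
  rw [key]
  -- Likewise, the disturbance and reference terms of the error cancel.
  refine (congrArg₂ (· - ·) (hz (n + 1)) (hz n)).trans ?_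
  simp only [map_sub, map_zero, map_add, hx]
  abel

end DiscreteTime

/-! ### Output regulation from closed-loop stability -/

section Regulation

variable {τ : ℝ} {X U₀ Ud₀ Y₀ Z : Type*}
  [NormedAddCommGroup X] [NormedSpace ℂ X] [CompleteSpace X]
  [NormedAddCommGroup U₀] [NormedSpace ℂ U₀]
  [NormedAddCommGroup Ud₀] [NormedSpace ℂ Ud₀]
  [NormedAddCommGroup Y₀] [NormedSpace ℂ Y₀]
  [NormedAddCommGroup Z] [NormedSpace ℂ Z]
  {S : PeriodicSystem τ X U₀ Ud₀ Y₀}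

theorem integral_norm_sq_eq {E : Type*} [NormedAddCommGroup E] (e : L2 τ E) :
    ∫ s in Ioc 0 τ, ‖e s‖ ^ 2 = ‖e‖ ^ 2 := by
  have hn : MemLp (fun t => ‖e t‖) 2 (volume.restrict (Ioc 0 τ)) := (Lp.memLp e).norm
  have h1 : ‖hn.toLp‖ = ‖e‖ := by
    rw [Lp.norm_toLp, eLpNorm_norm, Lp.norm_def]
  rw [← h1, ← real_inner_self_eq_norm_sq, L2.inner_def]
  refine integral_congr_ae ?_
  filter_upwards [hn.coeFn_toLp] with s hs
  rw [hs]
  simp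

/-- Passes from the norm of the lifted error back to the error integral over an actual period. -/
theorem integral_period_eq {E : Type*} [NormedAddCommGroup E] (hτ : 0 < τ) {f : ℝ → E} (a : ℝ)
    {e : L2 τ E} (he : e =ᵐ[volume.restrict (Ioc 0 τ)] fun s => f (a + s)) :
    IntervalIntegrable (fun t => ‖f t‖ ^ 2) volume a (a + τ) ∧
      ∫ t in a..(a + τ), ‖f t‖ ^ 2 = ‖e‖ ^ 2 := by
  have hf : MemLp f 2 (volume.restrict (Ioc a (a + τ))) :=
    (memLp_translate_iff a τ).1 ((memLp_congr_ae he).1 (Lp.memLp e))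
  constructor
  · rw [intervalIntegrable_iff_integrableOn_Ioc_of_le (by linarith)]
    exact hf.norm.integrable_sq
  · have h := intervalIntegral.integral_comp_add_left (a := 0) (b := τ)
      (fun t => ‖f t‖ ^ 2) a
    rw [add_zero] at h
    rw [← h, ← integral_norm_sq_eq, intervalIntegral.integral_of_le hτ.le]
    refine integral_congr_ae ?_
    filter_upwards [he] with s hs
    rw [hs]

/-- The class is the linear combination of the classes of the `w k`, and each coordinate of `v` is
at most `‖v‖`; this keeps later constants independent of `v`. -/
theorem exists_disturbance_class {q : ℕ} {w : Fin q → ℝ → Ud₀}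
    (hw : ∀ k, IsPeriodicSignal τ (w k)) :
    ∃ b : ℝ, 0 ≤ b ∧ ∀ v : EuclideanSpace ℂ (Fin q), ∃ W : L2 τ Ud₀,
      W =ᵐ[volume.restrict (Ioc 0 τ)] disturbance w v ∧ ‖W‖ ≤ b * ‖v‖ := by
  refine ⟨∑ k, ‖(hw k).2.toLp‖, Finset.sum_nonneg fun k _ => norm_nonneg _, fun v => ?_⟩
  refine ⟨∑ k, v k • (hw k).2.toLp, ?_, ?_⟩
  · have h1 : ∀ᵐ t ∂(volume.restrict (Ioc 0 τ)), ∀ k, (v k • (hw k).2.toLp : L2 τ Ud₀) t =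
        v k • w k t := by
      refine ae_all_iff.2 fun k => ?_
      filter_upwards [Lp.coeFn_smul (v k) (hw k).2.toLp, (hw k).2.coeFn_toLp] with t h1 h2
      rw [h1, Pi.smul_apply, h2]
    filter_upwards [h1, Lp.coeFn_finsetSum Finset.univ fun k => v k • (hw k).2.toLp]
      with t h1 h2
    rw [h2, Finset.sum_apply, disturbance]
    exact Finset.sum_congr rfl fun k _ => h1 k
  · rw [Finset.sum_mul]
    refine norm_sum_le_of_le _ fun k _ => ?_
    rw [norm_smul, mul_comm]
    exact mul_le_mul_of_nonneg_left (PiLp.norm_apply_le v k) (norm_nonneg _)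

theorem sq_sum_four_le (a b c d : ℝ) :
    (a + b + c + d) ^ 2 ≤ 4 * (a ^ 2 + b ^ 2 + c ^ 2 + d ^ 2) := by
  linarith [sq_nonneg (a - b), sq_nonneg (a - c), sq_nonneg (a - d), sq_nonneg (b - c),
    sq_nonneg (b - d), sq_nonneg (c - d)]

/-- The change of the states over the first period is bounded affinely in the initial states and
the amplitudes of the disturbance. -/
theorem exists_increment_bound (c : Controller τ U₀ Y₀ Z)
    (hG₁ : c.G₁ = ContinuousLinearMap.id ℂ Z) {yref : ℝ → Y₀} {q : ℕ} {w : Fin q → ℝ → Ud₀}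
    (hy : IsPeriodicSignal τ yref) (hw : ∀ k, IsPeriodicSignal τ (w k)) :
    ∃ a : ℝ, 0 ≤ a ∧ ∀ (x₀ : X) (z₀ : Z) (v : EuclideanSpace ℂ (Fin q)) (z : ℕ → Z),
      S.IsClosedLoop c yref (disturbance w v) x₀ z₀ z →
        ‖S.state x₀ (c.input z) (disturbance w v) τ - x₀‖ + ‖z 1 - z 0‖ ≤
          a * (‖x₀‖ + ‖z₀‖ + ‖v‖ + 1) := by
  obtain ⟨b, hb0, hb⟩ := exists_disturbance_class hw
  set V : L2 τ Y₀ := hy.2.toLp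
  have hV : V =ᵐ[volume.restrict (Ioc 0 τ)] yref := hy.2.coeFn_toLp
  set a₁ := ‖S.evol τ 0‖ + 1 + ‖c.G₂‖ * ‖S.observeOp‖
  set a₂ := ‖S.inputOp.comp c.K‖ + ‖c.G₂‖ * ‖S.feedOp.comp c.K‖
  set a₃ := ‖S.disturbStateOp‖ * b + ‖c.G₂‖ * (‖S.disturbOutputOp‖ * b)
  set a₄ := ‖c.G₂‖ * ‖V‖
  have ha₁ : 0 ≤ a₁ := by positivity
  have ha₂ : 0 ≤ a₂ := by positivity
  have ha₃ : 0 ≤ a₃ := by positivity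
  have ha₄ : 0 ≤ a₄ := by positivity
  refine ⟨a₁ + a₂ + a₃ + a₄, by positivity, fun x₀ z₀ v z hz => ?_⟩
  obtain ⟨W, hW, hWb⟩ := hb v
  have hw' := isPeriodicSignal_disturbance hw v
  obtain ⟨hz0, hrec⟩ := (S.isClosedLoop_iff c hw' hW hy hV x₀ z₀ z).1 hz
  have hx1 : ‖S.state x₀ (c.input z) (disturbance w v) τ - x₀‖ ≤
      (‖S.evol τ 0‖ + 1) * ‖x₀‖ + ‖S.inputOp.comp c.K‖ * ‖z₀‖ +
        ‖S.disturbStateOp‖ * b * ‖v‖ := by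
    have h1 := S.state_succ c hw' hW x₀ z 0
    simp only [zero_add, Nat.cast_one, one_mul, Nat.cast_zero, zero_mul, state_zero, hz0] at h1
    rw [h1]
    have e1 := (S.evol τ 0).le_opNorm x₀
    have e2 := (S.inputOp.comp c.K).le_opNorm z₀
    have e3 := S.disturbStateOp.le_opNorm_of_le hWb
    have e4 := norm_sub_le (S.evol τ 0 x₀ + S.inputOp (c.K z₀) + S.disturbStateOp W) x₀
    have e5 := norm_add₃_le (a := S.evol τ 0 x₀) (b := S.inputOp (c.K z₀))
      (c := S.disturbStateOp W)
    rw [ContinuousLinearMap.comp_apply] at e2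
    linarith
  have hz1 : ‖z 1 - z 0‖ ≤ ‖c.G₂‖ * (‖S.observeOp‖ * ‖x₀‖ + ‖S.feedOp.comp c.K‖ * ‖z₀‖ +
      ‖S.disturbOutputOp‖ * b * ‖v‖ + ‖V‖) := by
    have h1 := hrec 0
    simp only [zero_add, Nat.cast_zero, zero_mul, state_zero, hz0] at h1
    rw [hz0, h1, hG₁, ContinuousLinearMap.id_apply, add_sub_cancel_left]
    refine c.G₂.le_opNorm_of_le ?_
    have e1 := S.observeOp.le_opNorm x₀
    have e2 := (S.feedOp.comp c.K).le_opNorm z₀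
    have e3 := S.disturbOutputOp.le_opNorm_of_le hWb
    have e4 := norm_sub_le (S.observeOp x₀ + S.feedOp (c.K z₀) + S.disturbOutputOp W) V
    have e5 := norm_add₃_le (a := S.observeOp x₀) (b := S.feedOp (c.K z₀))
      (c := S.disturbOutputOp W)
    rw [ContinuousLinearMap.comp_apply] at e2
    linarith
  set r := ‖x₀‖ + ‖z₀‖ + ‖v‖ + 1 with hr
  have e1 : a₁ * ‖x₀‖ ≤ a₁ * r := by gcongr; linarith [norm_nonneg z₀, norm_nonneg v]
  have e2 : a₂ * ‖z₀‖ ≤ a₂ * r := by gcongr; linarith [norm_nonneg x₀, norm_nonneg v]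
  have e3 : a₃ * ‖v‖ ≤ a₃ * r := by gcongr; linarith [norm_nonneg z₀, norm_nonneg x₀]
  have e4 : a₄ * 1 ≤ a₄ * r := by
    gcongr; linarith [norm_nonneg z₀, norm_nonneg x₀, norm_nonneg v]
  rw [add_mul, add_mul, add_mul]
  refine (add_le_add hx1 hz1).trans (le_trans (le_of_eq ?_)
    (add_le_add (add_le_add (add_le_add e1 e2) e3) e4))
  simp only [a₁, a₂, a₃, a₄]
  ring

/-- A controller with `G₁ = I` and `G₂` bounded below achieves output regulation for all periodic
signals as soon as the closed loop is exponentially stable. -/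
theorem ClosedLoopExpStable.regulates {c : Controller τ U₀ Y₀ Z}
    (h : S.ClosedLoopExpStable c) (hG₁ : c.G₁ = ContinuousLinearMap.id ℂ Z) {κ : ℝ}
    (hκ0 : 0 ≤ κ) (hκ : ∀ e, ‖e‖ ≤ κ * ‖c.G₂ e‖) {yref : ℝ → Y₀} {q : ℕ} {w : Fin q → ℝ → Ud₀}
    (hy : IsPeriodicSignal τ yref) (hw : ∀ k, IsPeriodicSignal τ (w k)) :
    S.Regulates c yref w := by
  obtain ⟨_, _, M, hM, _, _, α, hα, h⟩ := h
  have hτ := S.period_pos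
  obtain ⟨a, ha0, ha⟩ := exists_increment_bound (S := S) c hG₁ hy hw
  -- The factor 2 comes from squaring a sum of four terms; the added 1 only keeps the constant
  -- positive. The rate is that of the controller state.
  refine ⟨2 * (κ * M * a) + 1, by positivity, α, hα, fun x₀ z₀ v z hz n => ?_⟩
  have hw' := isPeriodicSignal_disturbance hw v
  have hinc := (h _ _ _ (IsClosedLoop.increments S hw' hy hz)).2 n
  have hinit := ha x₀ z₀ v z hz
  have hW := hw'.2.coeFn_toLp
  have hV := hy.2.coeFn_toLp
  obtain ⟨-, hrec⟩ := (S.isClosedLoop_iff c hw' hW hy hV x₀ z₀ z).1 hz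
  -- Since `G₁` is the identity, the increment of the controller state is exactly `G₂` applied to
  -- the error.
  have hstep : ∀ m, z (m + 1) - z m = c.G₂ (S.observeOp (S.state x₀ (c.input z)
      (disturbance w v) (m * τ)) + S.feedOp (c.K (z m)) + S.disturbOutputOp hw'.2.toLp - hy.2.toLp) := by
    intro m
    rw [hrec m, hG₁]
    simp
  set r := ‖x₀‖ + ‖z₀‖ + ‖v‖ + 1 with hr
  set E : L2 τ Y₀ := S.observeOp (S.state x₀ (c.input z) (disturbance w v) (n * τ)) +
    S.feedOp (c.K (z n)) + S.disturbOutputOp hw'.2.toLp - hy.2.toLp with hE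
  have hnorm : ‖E‖ ≤ κ * M * a * Real.exp (-α * n) * r := by
    calc ‖E‖ ≤ κ * ‖c.G₂ E‖ := hκ E
      _ = κ * ‖z (n + 1) - z n‖ := by rw [hstep n]
      _ ≤ κ * (M * Real.exp (-α * n) * (a * r)) := by
          gcongr
          exact hinc.trans (by gcongr)
      _ = κ * M * a * Real.exp (-α * n) * r := by ring
  have hint := integral_period_eq hτ
    (f := fun t => S.output x₀ (c.input z) (disturbance w v) t - yref t) (n * τ)
    (S.error_period c hw' hW hy hV x₀ z n)
  rw [show ((n : ℝ) + 1) * τ = n * τ + τ by ring]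
  refine ⟨hint.1, ?_⟩
  rw [hint.2]
  have hr2 : r ^ 2 ≤ 4 * (‖x₀‖ ^ 2 + ‖z₀‖ ^ 2 + ‖v‖ ^ 2 + 1) := by
    simpa using sq_sum_four_le ‖x₀‖ ‖z₀‖ ‖v‖ 1
  have hexp : Real.exp (-2 * α * n) = Real.exp (-α * n) ^ 2 := by
    rw [← Real.exp_nat_mul]
    congr 1
    push_cast
    ring
  have hκMa : 0 ≤ κ * M * a := by positivity
  calc ‖E‖ ^ 2 ≤ (κ * M * a * Real.exp (-α * n) * r) ^ 2 := by gcongr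
    _ = (κ * M * a) ^ 2 * Real.exp (-2 * α * n) * r ^ 2 := by rw [hexp]; ring
    _ ≤ (κ * M * a) ^ 2 * Real.exp (-2 * α * n) *
        (4 * (‖x₀‖ ^ 2 + ‖z₀‖ ^ 2 + ‖v‖ ^ 2 + 1)) := by gcongr
    _ = (2 * (κ * M * a)) ^ 2 * Real.exp (-2 * α * n) *
        (‖x₀‖ ^ 2 + ‖z₀‖ ^ 2 + ‖v‖ ^ 2 + 1) := by ring
    _ ≤ (2 * (κ * M * a) + 1) ^ 2 * Real.exp (-2 * α * n) *
        (‖x₀‖ ^ 2 + ‖z₀‖ ^ 2 + ‖v‖ ^ 2 + 1) := by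
      gcongr
      linarith

end Regulation

end PeriodicSystem

/-! ### Adapted norms, spectrum and low-gain stability in discrete time -/

section DiscreteStability

/-- If some power of `A` has norm less than one, then `A` is a strict contraction with respect to
an equivalent norm. -/
theorem exists_contracting_seminorm {E : Type*} [NormedAddCommGroup E] [NormedSpace ℂ E]
    (A : E →L[ℂ] E) {m : ℕ} (hm : 0 < m) (h : ‖A ^ m‖ < 1) :
    ∃ ρ : ℝ, 0 < ρ ∧ ρ < 1 ∧ ∃ (p : Seminorm ℂ E) (C : ℝ), 0 ≤ C ∧ (∀ x, ‖x‖ ≤ p x) ∧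
      (∀ x, p x ≤ C * ‖x‖) ∧ ∀ x, p (A x) ≤ ρ * p x := by
  obtain ⟨δ, hδ, hδ1⟩ : ∃ δ : ℝ, max ‖A ^ m‖ (1 / 2) < δ ∧ δ < 1 :=
    exists_between (max_lt h (by norm_num))
  have hδ0 : 0 < δ := lt_of_lt_of_le (by norm_num) ((le_max_right _ _).trans hδ.le)
  obtain ⟨ρ, hρ0, hρm⟩ : ∃ ρ : ℝ, 0 ≤ ρ ∧ ρ ^ m = δ :=
    ⟨δ ^ ((m : ℝ)⁻¹), Real.rpow_nonneg hδ0.le _, Real.rpow_inv_natCast_pow hδ0.le hm.ne'⟩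
  have hρ : 0 < ρ := lt_of_le_of_ne hρ0 fun h0 => by
    rw [← h0, zero_pow hm.ne'] at hρm
    exact hδ0.ne hρm
  have hρ1 : ρ < 1 := by
    by_contra hcon
    have := one_le_pow₀ (n := m) (not_lt.1 hcon)
    linarith
  -- The adapted norm is the sum of these terms over `k < m`. Applying `A` shifts the sum and gains
  -- a factor `ρ`; the new term `k = m` is at most the lost term `k = 0` because `ρ ^ m = δ` exceeds
  -- `‖A ^ m‖`.
  let f : ℕ → E → ℝ := fun k x => ρ⁻¹ ^ k * ‖(A ^ k) x‖
  have hf0 : ∀ k x, 0 ≤ f k x := fun k x => by positivity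
  let p : Seminorm ℂ E := Seminorm.of (fun x => ∑ k ∈ Finset.range m, f k x)
    (fun x y => by
      rw [← Finset.sum_add_distrib]
      refine Finset.sum_le_sum fun k _ => ?_
      simp only [f, map_add, ← mul_add]
      exact mul_le_mul_of_nonneg_left (norm_add_le _ _) (by positivity))
    (fun a x => by
      rw [Finset.mul_sum]
      refine Finset.sum_congr rfl fun k _ => ?_
      simp only [f, map_smul, norm_smul]
      ring)
  have hp : ∀ x, p x = ∑ k ∈ Finset.range m, f k x := fun x => rfl
  refine ⟨ρ, hρ, hρ1, p, ∑ k ∈ Finset.range m, ρ⁻¹ ^ k * ‖A ^ k‖,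
    Finset.sum_nonneg fun k _ => by positivity, fun x => ?_, fun x => ?_, fun x => ?_⟩
  · rw [hp]
    refine le_trans (le_of_eq ?_)
      (Finset.single_le_sum (fun k _ => hf0 k x) (Finset.mem_range.2 hm))
    simp [f]
  · rw [hp, Finset.sum_mul]
    refine Finset.sum_le_sum fun k _ => ?_
    simp only [f, mul_assoc]
    exact mul_le_mul_of_nonneg_left ((A ^ k).le_opNorm x) (by positivity)
  · have h1 : p (A x) = ρ * ∑ k ∈ Finset.range m, f (k + 1) x := by
      rw [hp, Finset.mul_sum]
      refine Finset.sum_congr rfl fun k _ => ?_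
      simp only [f]
      rw [pow_succ A k, mul_apply_eq_comp, pow_succ ρ⁻¹ k]
      field_simp
    have h2 : f m x ≤ f 0 x := by
      have h3 : ‖(A ^ m) x‖ ≤ δ * ‖x‖ :=
        (A ^ m).le_of_opNorm_le ((le_max_left _ _).trans hδ.le) x
      simp only [f, inv_pow, hρm, pow_zero, inv_one, one_mul, one_apply_eq_self]
      rw [inv_mul_le_iff₀ hδ0]
      exact h3
    have h4 := Finset.sum_range_succ (fun k => f k x) m
    rw [Finset.sum_range_succ'] at h4
    rw [h1, hp]
    exact mul_le_mul_of_nonneg_left (by linarith) hρ.le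

/-- If the spectrum of `Q` lies in the open left half-plane, then some power of `1 + ε Q` is a
contraction for suitable `ε > 0`. -/
theorem exists_norm_one_add_smul_pow_lt_one {A : Type*} [NormedRing A] [NormedAlgebra ℂ A]
    [CompleteSpace A] (Q : A) (hQ : ∀ μ ∈ spectrum ℂ Q, μ.re < 0) :
    ∃ ε : ℝ, 0 < ε ∧ ∃ m : ℕ, 0 < m ∧ ‖(1 + (ε : ℂ) • Q) ^ m‖ < 1 := by
  have hcomp := spectrum.isCompact (𝕜 := ℂ) Q
  obtain ⟨b, hb0, hb⟩ : ∃ b : ℝ, 0 < b ∧ ∀ μ ∈ spectrum ℂ Q, μ.re ≤ -b := by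
    rcases (spectrum ℂ Q).eq_empty_or_nonempty with he | hne
    · exact ⟨1, one_pos, by simp [he]⟩
    · obtain ⟨μ₀, hμ₀, hmax⟩ := hcomp.exists_isMaxOn hne Complex.continuous_re.continuousOn
      exact ⟨-μ₀.re, by linarith [hQ μ₀ hμ₀], fun μ hμ => by
        have : μ.re ≤ μ₀.re := hmax hμ
        linarith⟩
  obtain ⟨L, hL0, hL⟩ := hcomp.isBounded.exists_pos_norm_le
  -- For ν in the spectrum of Q, |1 + εν|² = 1 + 2ε Re ν + ε²|ν|² ≤ 1 - 2εb + ε²L², which equals 1 -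
  -- εb for this choice.
  set ε := b / L ^ 2 with hε
  have hε0 : 0 < ε := by positivity
  have hεL : ε * L ^ 2 = b := by rw [hε]; field_simp
  refine ⟨ε, hε0, ?_⟩
  set P := 1 + (ε : ℂ) • Q with hP
  have hspec : ∀ μ ∈ spectrum ℂ P, ‖μ‖ < 1 := by
    intro μ hμ
    have h1 : (μ - 1) / ε ∈ spectrum ℂ Q := by
      have hε' : (ε : ℂ) ≠ 0 := by exact_mod_cast hε0.ne'
      rw [spectrum.mem_iff] at hμ ⊢
      contrapose! hμ
      have h2 : algebraMap ℂ A μ - P =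
          (ε : ℂ) • (algebraMap ℂ A ((μ - 1) / ε) - Q) := by
        rw [hP, smul_sub, Algebra.algebraMap_eq_smul_one, Algebra.algebraMap_eq_smul_one,
          smul_smul, mul_div_cancel₀ _ hε', sub_smul, one_smul]
        abel
      rw [h2]
      exact (IsUnit.smul (Units.mk0 _ hε') hμ :)
    set ν := (μ - 1) / ε with hν
    have hμν : μ = 1 + ε * ν := by
      have hε' : (ε : ℂ) ≠ 0 := by exact_mod_cast hε0.ne'
      rw [hν]; field_simp; ring
    have h3 := hb ν h1
    have h4 := hL ν h1
    have h5 : ‖ν‖ ^ 2 = ν.re ^ 2 + ν.im ^ 2 := by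
      rw [Complex.sq_norm, Complex.normSq_apply]; ring
    have h6 : ‖μ‖ ^ 2 = 1 + 2 * ε * ν.re + ε * (ε * ‖ν‖ ^ 2) := by
      rw [h5, Complex.sq_norm, Complex.normSq_apply, hμν]
      simp
      ring
    have h7 : ε * ‖ν‖ ^ 2 ≤ b := by
      rw [← hεL]
      gcongr
    have h8 : ‖μ‖ ^ 2 < 1 ^ 2 := by
      rw [h6]
      nlinarith [mul_pos hε0 hb0]
    exact lt_of_pow_lt_pow_left₀ 2 zero_le_one h8
  have hrad : spectralRadius ℂ P < 1 := by
    -- The spectrum is empty in the trivial algebra, which occurs when the output space is zero.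
    rcases (spectrum ℂ P).eq_empty_or_nonempty with he | hne
    · simp [spectralRadius, he]
    · exact_mod_cast spectrum.spectralRadius_lt_of_forall_lt_of_nonempty hne (r := 1)
        fun k hk => by exact_mod_cast hspec k hk
  -- Gelfand's formula: spectral radius below 1 forces some power to have norm below 1.
  have hlim := spectrum.pow_nnnorm_pow_one_div_tendsto_nhds_spectralRadius P
  obtain ⟨m, hm, hm0⟩ := ((hlim.eventually (gt_mem_nhds hrad)).and
    (eventually_gt_atTop 0)).exists
  refine ⟨m, hm0, ?_⟩
  by_contra hcon
  have h1 : (1 : ℝ≥0∞) ≤ ‖P ^ m‖₊ := by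
    exact_mod_cast not_lt.1 hcon
  exact absurd hm (not_lt.2 (ENNReal.one_le_rpow h1 (by positivity)))

/-- A small-gain estimate for two coupled scalar recursive inequalities. -/
theorem exists_weighted_contraction {c r α β δ : ℝ} (hc : 0 < c) (hr1 : r < 1) (hα : 0 ≤ α)
    (hβ : 0 ≤ β) (hδ : 0 ≤ δ) :
    ∃ κ > 0, ∃ ε' > 0, ∀ ε, 0 < ε → ε ≤ ε' → 0 < 1 - ε * c / 2 ∧ ∀ a b a' b' : ℝ,
      0 ≤ a → 0 ≤ b → a' ≤ (1 - ε * c) * a + ε * α * b →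
      b' ≤ (r + ε * β) * b + ε * δ * a → a' + κ * b' ≤ (1 - ε * c / 2) * (a + κ * b) := by
  -- The weight is so small that the feedback of `a` into `b` costs at most half of the decay `ε *
  -- c` of `a`. It does not depend on `ε`.
  set κ := c / (2 * (δ + 1)) with hκ
  have hκ0 : 0 < κ := by positivity
  have hκδ : κ * δ ≤ c / 2 := by
    have : κ * (δ + 1) = c / 2 := by rw [hκ]; field_simp
    linarith
  -- Comparing coefficients of `b` in the claim leaves exactly `ε * D ≤ κ * (1 - r)`.
  set D := α + κ * β + κ * c / 2 with hD
  have hD0 : 0 < D := by positivity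
  have hr : 0 < 1 - r := by linarith
  refine ⟨κ, hκ0, min (κ * (1 - r) / D) (1 / c), lt_min (by positivity) (by positivity),
    fun ε hε hle => ⟨?_, fun a b a' b' ha hb h1 h2 => ?_⟩⟩
  · have := (le_div_iff₀ hc).1 (hle.trans (min_le_right _ _))
    linarith
  · have h3 : ε * D ≤ κ * (1 - r) := (le_div_iff₀ hD0).1 (hle.trans (min_le_left _ _))
    have h4 := mul_le_mul_of_nonneg_left h2 hκ0.le
    have h5 := mul_le_mul_of_nonneg_right h3 hb
    have h6 := mul_le_mul_of_nonneg_right (mul_le_mul_of_nonneg_left hκδ hε.le) ha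
    rw [hD] at h5
    linarith

variable {X U Y Z : Type*} [NormedAddCommGroup X] [NormedSpace ℂ X]
  [NormedAddCommGroup U] [NormedSpace ℂ U] [NormedAddCommGroup Y] [NormedSpace ℂ Y]
  [NormedAddCommGroup Z] [NormedSpace ℂ Z]

/-- Low-gain integral control of a stable discrete-time linear system. -/
theorem exists_low_gain_stable {T R : X →L[ℂ] X} {B : U →L[ℂ] X} {C : X →L[ℂ] Y}
    {D : U →L[ℂ] Y} {G : Y →L[ℂ] Z} {K : Z →L[ℂ] U} {m : ℕ} (hm : 0 < m) (hT : ‖T ^ m‖ < 1)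
    (hR : R * (1 - T) = 1) {Q : Z →L[ℂ] Z} (hQ : Q = G.comp ((C.comp (R.comp B) + D).comp K))
    {ε₀ : ℝ} (hε₀ : 0 < ε₀) {k : ℕ} (hk : 0 < k) (hQk : ‖(1 + (ε₀ : ℂ) • Q) ^ k‖ < 1) :
    ∃ ε' : ℝ, 0 < ε' ∧ ∀ ε : ℝ, 0 < ε → ε ≤ ε' → ∃ ρ M : ℝ, 0 < ρ ∧ ρ < 1 ∧ 0 < M ∧
      ∀ (x : ℕ → X) (z : ℕ → Z),
        (∀ n, x (n + 1) = T (x n) + B (((ε : ℂ) • K) (z n))) →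
        (∀ n, z (n + 1) = z n + G (C (x n) + D (((ε : ℂ) • K) (z n)))) →
        ∀ n, ‖x n‖ + ‖z n‖ ≤ M * ρ ^ n * (‖x 0‖ + ‖z 0‖) := by
  obtain ⟨r, hr0, hr1, p', C', hC'0, hp'1, hp'2, hp'3⟩ := exists_contracting_seminorm T hm hT
  obtain ⟨σ, hσ0, hσ1, p, C₁, hC₁0, hp1, hp2, hp3⟩ := exists_contracting_seminorm _ hk hQk
  -- `N` solves N T + G C = N, so passing from `z` to z + N x eliminates the output of the free
  -- motion from the integrator.
  set N : X →L[ℂ] Z := G.comp (C.comp R) with hN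
  -- The roles of `a` and `b` are played by the adapted norms of `q n` and `x n`; `c` is the decay
  -- of 1 + εQ per unit of ε.
  obtain ⟨κ, hκ, ε', hε', hstep⟩ := exists_weighted_contraction (c := (1 - σ) / ε₀) (r := r)
    (α := C₁ * ‖Q.comp N‖) (β := C' * ‖B.comp (K.comp N)‖) (δ := C' * ‖B.comp K‖)
    (div_pos (by linarith) hε₀) hr1 (by positivity) (by positivity) (by positivity)
  refine ⟨min ε' ε₀, lt_min hε' hε₀, fun ε hε hle => ?_⟩
  obtain ⟨hρ0, hstep⟩ := hstep ε hε (hle.trans (min_le_left _ _))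
  have hεε₀ : ε ≤ ε₀ := hle.trans (min_le_right _ _)
  set ρ := 1 - ε * ((1 - σ) / ε₀) / 2 with hρ
  have hρ1 : ρ < 1 := by
    have : 0 < ε * ((1 - σ) / ε₀) := mul_pos hε (div_pos (by linarith) hε₀)
    linarith
  set M₂ := C₁ * (1 + ‖N‖) + κ * C' with hM₂
  have hM₂0 : 0 ≤ M₂ := by positivity
  have hnormε : ‖(ε : ℂ)‖ = ε := by rw [Complex.norm_real, Real.norm_of_nonneg hε.le]
  refine ⟨ρ, (1 + κ⁻¹ * (1 + ‖N‖)) * M₂ + 1, hρ0, hρ1, by positivity, fun x z hx hz n => ?_⟩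
  set q : ℕ → Z := fun n => z n + N (x n) with hq
  have hzq : ∀ n, z n = q n - N (x n) := fun n => by simp [hq]
  have hNT : ∀ y, N (T y) + G (C y) = N y := by
    intro y
    have h1 : R (y - T y) = y := by
      have := congrArg (fun f : X →L[ℂ] X => f y) hR
      simpa using this
    have h2 : G (C y) = N y - N (T y) := by
      rw [← map_sub]
      simp only [hN, ContinuousLinearMap.comp_apply, h1]
    rw [h2]
    abel
  have hqrec : ∀ n, q (n + 1) = q n + (ε : ℂ) • Q (z n) := by
    intro n
    have h1 := hNT (x n)
    have h2 : (ε : ℂ) • Q (z n) =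
        N (B (((ε : ℂ) • K) (z n))) + G (D (((ε : ℂ) • K) (z n))) := by
      rw [hQ]
      simp only [hN, ContinuousLinearMap.comp_apply, add_apply, smul_apply,
        map_smul, map_add, smul_add]
    show z (n + 1) + N (x (n + 1)) = z n + N (x n) + _
    rw [hz n, hx n, h2, ← h1, map_add, map_add]
    abel
  -- 1 + εQ is the convex combination of 1 and 1 + ε₀Q with weights 1 - t and t. One norm adapted to
  -- ε₀ thus serves all smaller gains, with contraction factor 1 - t(1 - σ).
  set t : ℝ := ε / ε₀ with ht
  have ht0 : 0 ≤ t := by positivity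
  have ht1 : 0 ≤ 1 - t := by
    have : t ≤ 1 := (div_le_one hε₀).2 hεε₀
    linarith
  have htε : t * ε₀ = ε := by rw [ht]; field_simp
  have hV : ∀ n, p (q (n + 1)) + κ * p' (x (n + 1)) ≤ ρ * (p (q n) + κ * p' (x n)) := by
    intro n
    refine hstep _ _ _ _ (apply_nonneg p _) (apply_nonneg p' _) ?_ ?_
    · have h1 : q (n + 1) = ((1 - t : ℝ) : ℂ) • q n +
          (t : ℂ) • ((1 + (ε₀ : ℂ) • Q) (q n)) - (ε : ℂ) • (Q.comp N) (x n) := by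
        rw [hqrec, hzq n, ← htε]
        simp only [map_sub, add_apply, smul_apply,
          one_apply_eq_self, ContinuousLinearMap.comp_apply, smul_add, smul_sub,
          smul_smul, Complex.ofReal_sub, Complex.ofReal_one, sub_smul, one_smul,
          Complex.ofReal_mul]
        abel
      rw [h1]
      refine (map_sub_le_add p _ _).trans ((add_le_add (map_add_le_add p _ _) le_rfl).trans ?_)
      rw [map_smul_eq_mul, map_smul_eq_mul, map_smul_eq_mul, hnormε, Complex.norm_real,
        Complex.norm_real, Real.norm_of_nonneg ht0, Real.norm_of_nonneg ht1]
      have h2 := mul_le_mul_of_nonneg_left (hp3 (q n)) ht0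
      have h3 : p ((Q.comp N) (x n)) ≤ C₁ * ‖Q.comp N‖ * p' (x n) := by
        rw [mul_assoc]
        refine (hp2 _).trans (mul_le_mul_of_nonneg_left ?_ hC₁0)
        exact (Q.comp N).le_opNorm_of_le (hp'1 _)
      have h4 := mul_le_mul_of_nonneg_left h3 hε.le
      have h5 : (1 - ε * ((1 - σ) / ε₀)) * p (q n) =
          (1 - t) * p (q n) + t * (σ * p (q n)) := by rw [ht]; ring
      rw [h5]
      linarith
    · have h1 : x (n + 1) = T (x n) + (ε : ℂ) • (B.comp K) (q n) -
          (ε : ℂ) • (B.comp (K.comp N)) (x n) := by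
        rw [hx, hzq n]
        simp only [map_sub, smul_apply, ContinuousLinearMap.comp_apply, map_smul]
        abel
      rw [h1]
      refine (map_sub_le_add p' _ _).trans
        ((add_le_add (map_add_le_add p' _ _) le_rfl).trans ?_)
      rw [map_smul_eq_mul, map_smul_eq_mul, hnormε]
      have h2 := hp'3 (x n)
      have h3 : p' ((B.comp K) (q n)) ≤ C' * ‖B.comp K‖ * p (q n) := by
        rw [mul_assoc]
        refine (hp'2 _).trans (mul_le_mul_of_nonneg_left ?_ hC'0)
        exact (B.comp K).le_opNorm_of_le (hp1 _)
      have h4 : p' ((B.comp (K.comp N)) (x n)) ≤ C' * ‖B.comp (K.comp N)‖ * p' (x n) := by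
        rw [mul_assoc]
        refine (hp'2 _).trans (mul_le_mul_of_nonneg_left ?_ hC'0)
        exact (B.comp (K.comp N)).le_opNorm_of_le (hp'1 _)
      have h5 := mul_le_mul_of_nonneg_left h3 hε.le
      have h6 := mul_le_mul_of_nonneg_left h4 hε.le
      linarith
  have hVn : p (q n) + κ * p' (x n) ≤ ρ ^ n * (p (q 0) + κ * p' (x 0)) := by
    induction n with
    | zero => simp
    | succ n ih =>
      calc _ ≤ ρ * (p (q n) + κ * p' (x n)) := hV n
        _ ≤ ρ * (ρ ^ n * (p (q 0) + κ * p' (x 0))) := by gcongr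
        _ = _ := by ring
  set v := p (q n) + κ * p' (x n) with hv
  have hxn : ‖x n‖ ≤ κ⁻¹ * v := by
    rw [← div_eq_inv_mul, le_div_iff₀ hκ, mul_comm]
    have h1 := mul_le_mul_of_nonneg_left (hp'1 (x n)) hκ.le
    have h2 := apply_nonneg p (q n)
    linarith
  have hqn : ‖q n‖ ≤ v := by
    have h1 := hp1 (q n)
    have h2 := mul_nonneg hκ.le (apply_nonneg p' (x n))
    linarith
  have hzn : ‖z n‖ ≤ v + ‖N‖ * (κ⁻¹ * v) := by
    rw [hzq n]
    exact (norm_sub_le _ _).trans (add_le_add hqn (N.le_opNorm_of_le hxn))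
  have hv0 : p (q 0) + κ * p' (x 0) ≤ M₂ * (‖x 0‖ + ‖z 0‖) := by
    have h1 : ‖q 0‖ ≤ ‖z 0‖ + ‖N‖ * ‖x 0‖ :=
      (norm_add_le _ _).trans (add_le_add le_rfl (N.le_opNorm _))
    have h2 := (hp2 (q 0)).trans (mul_le_mul_of_nonneg_left h1 hC₁0)
    have h3 := mul_le_mul_of_nonneg_left (hp'2 (x 0)) hκ.le
    have h4 : 0 ≤ C₁ * ‖x 0‖ + C₁ * ‖N‖ * ‖z 0‖ + κ * C' * ‖z 0‖ := by positivity
    rw [hM₂]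
    linarith
  have hfin : ‖x n‖ + ‖z n‖ ≤ (1 + κ⁻¹ * (1 + ‖N‖)) * v := by linarith
  have hpos : 0 ≤ ρ ^ n * (‖x 0‖ + ‖z 0‖) := by positivity
  calc ‖x n‖ + ‖z n‖ ≤ (1 + κ⁻¹ * (1 + ‖N‖)) * v := hfin
    _ ≤ (1 + κ⁻¹ * (1 + ‖N‖)) * (ρ ^ n * (M₂ * (‖x 0‖ + ‖z 0‖))) := by
        refine mul_le_mul_of_nonneg_left (hVn.trans ?_) (by positivity)
        gcongr
    _ ≤ ((1 + κ⁻¹ * (1 + ‖N‖)) * M₂ + 1) * ρ ^ n * (‖x 0‖ + ‖z 0‖) := by linarith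

end DiscreteStability

namespace PeriodicSystem

/-! ### From discrete-time decay to stability of the continuous-time closed loop -/

section ClosedLoopStability

variable {τ : ℝ} {X U₀ Ud₀ Y₀ Z : Type*}
  [NormedAddCommGroup X] [NormedSpace ℂ X]
  [NormedAddCommGroup U₀] [NormedSpace ℂ U₀]
  [NormedAddCommGroup Ud₀] [NormedSpace ℂ Ud₀]
  [NormedAddCommGroup Y₀] [NormedSpace ℂ Y₀]
  [NormedAddCommGroup Z] [NormedSpace ℂ Z]
  (S : PeriodicSystem τ X U₀ Ud₀ Y₀)

theorem evol_period_pow (n : ℕ) : S.evol τ 0 ^ n = S.evol (n * τ) 0 := by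
  have hτ := S.period_pos
  induction n with
  | zero =>
    rw [pow_zero, Nat.cast_zero, zero_mul, S.evol_self]
    rfl
  | succ n ih =>
    have h1 := S.evol_comp 0 (n * τ) (n * τ + τ) (by positivity) (by linarith)
    have h2 := S.evol_shift n hτ.le
    rw [add_zero] at h2
    rw [pow_succ', ih, ← h2, show ((n + 1 : ℕ) : ℝ) * τ = n * τ + τ by push_cast; ring]
    exact h1

variable {S} in
-- The constant `M` may exceed 1, so only a high power of the period map need be a contraction.
theorem ExpStable.exists_norm_pow_lt_one (hS : S.ExpStable) :
    ∃ m : ℕ, 0 < m ∧ ‖S.evol τ 0 ^ m‖ < 1 := by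
  obtain ⟨M, hM, ω, hω, h⟩ := hS
  have hτ := S.period_pos
  have hlim : Tendsto (fun n : ℕ => M * Real.exp (-((ω * τ) * (n : ℝ)))) atTop (𝓝 (M * 0)) :=
    Tendsto.const_mul M (Real.tendsto_exp_neg_atTop_nhds_zero.comp
      (tendsto_natCast_atTop_atTop.const_mul_atTop (mul_pos hω hτ)))
  rw [mul_zero] at hlim
  obtain ⟨m, hm, hm0⟩ := ((hlim.eventually (gt_mem_nhds one_pos)).and
    (eventually_gt_atTop 0)).exists
  refine ⟨m, hm0, ?_⟩
  rw [S.evol_period_pow]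
  refine (h 0 (m * τ) (by positivity)).trans_lt ?_
  rwa [show -ω * (m * τ - 0) = -((ω * τ) * m) by ring]

/-- Exponential stability of the closed loop follows from that of its discrete-time lifting. -/
theorem closedLoopExpStable_of_discrete [CompleteSpace X] {c : Controller τ U₀ Y₀ Z} {ρ M : ℝ}
    (hρ : 0 < ρ) (hρ1 : ρ < 1) (hM : 0 < M)
    (h : ∀ (x : ℕ → X) (z : ℕ → Z),
      (∀ n, x (n + 1) = S.evol τ 0 (x n) + S.inputOp (c.K (z n))) →
      (∀ n, z (n + 1) = c.G₁ (z n) + c.G₂ (S.observeOp (x n) + S.feedOp (c.K (z n)))) →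
      ∀ n, ‖x n‖ + ‖z n‖ ≤ M * ρ ^ n * (‖x 0‖ + ‖z 0‖)) :
    S.ClosedLoopExpStable c := by
  have hτ := S.period_pos
  obtain ⟨N, hN0, hN⟩ := S.evol_bounded τ
  obtain ⟨k, hk0, hk⟩ := S.exists_convolution_bound
  -- Bounds the state at any time within a period by the samples at the start of that period.
  set A := N + k * ‖(mulOp τ S.B_memLp).comp c.K‖ with hA
  have hA0 : 0 ≤ A := by positivity
  set α := -Real.log ρ with hα
  have hα0 : 0 < α := neg_pos.2 (Real.log_neg hρ hρ1)
  have hρα : ∀ n : ℕ, ρ ^ n = Real.exp (-α * n) := by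
    intro n
    rw [hα, neg_neg, mul_comm, Real.exp_nat_mul, Real.exp_log hρ]
  refine ⟨A * M * Real.exp α + 1, by positivity, M, hM, α / τ, div_pos hα0 hτ, α, hα0,
    fun x₀ z₀ z hz => ?_⟩
  have hW : (0 : L2 τ Ud₀) =ᵐ[volume.restrict (Ioc 0 τ)] (0 : ℝ → Ud₀) := Lp.coeFn_zero _ _ _
  have hV : (0 : L2 τ Y₀) =ᵐ[volume.restrict (Ioc 0 τ)] (0 : ℝ → Y₀) := Lp.coeFn_zero _ _ _
  have hw : IsPeriodicSignal τ (0 : ℝ → Ud₀) := isPeriodicSignal_zero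
  obtain ⟨hz0, hrec⟩ := (S.isClosedLoop_iff c hw hW isPeriodicSignal_zero hV x₀ z₀ z).1 hz
  set x : ℕ → X := fun n => S.state x₀ (c.input z) 0 (n * τ) with hx
  have hx0 : x 0 = x₀ := by simp [hx, state_zero]
  have hdecay := h x z
    (fun n => (S.state_succ c hw hW x₀ z n).trans (by rw [map_zero, add_zero]))
    (fun n => by simpa [map_zero] using hrec n)
  rw [hx0, hz0] at hdecay
  refine ⟨fun t ht => ?_, fun n => ?_⟩
  · set n := ⌊t / τ⌋₊ with hn
    have h1 : (n : ℝ) ≤ t / τ := Nat.floor_le (by positivity)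
    have h2 : t / τ < n + 1 := Nat.lt_floor_add_one _
    have h3 : n * τ ≤ t := (le_div_iff₀ hτ).1 h1
    have h4 : t < (n + 1) * τ := (div_lt_iff₀ hτ).1 h2
    have hs : t - n * τ ∈ Icc 0 τ := ⟨by linarith, by linarith⟩
    have h5 := S.state_period c hw hW x₀ z n hs
    rw [add_sub_cancel, map_zero, add_zero] at h5
    have h6 : ‖S.state x₀ (c.input z) 0 t‖ ≤ A * (‖x n‖ + ‖z n‖) := by
      rw [h5]
      have e1 : ‖S.evol (t - n * τ) 0 (x n)‖ ≤ N * ‖x n‖ :=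
        (S.evol _ 0).le_of_opNorm_le (hN _ _ le_rfl hs.1 hs.2) _
      have e2 := (hk (mulOp τ S.B_memLp (c.K (z n))) _ hs).trans (mul_le_mul_of_nonneg_left
        (((mulOp τ S.B_memLp).comp c.K).le_opNorm (z n)) hk0)
      have e3 : 0 ≤ N * ‖z n‖ + k * ‖(mulOp τ S.B_memLp).comp c.K‖ * ‖x n‖ := by positivity
      refine (norm_add_le _ _).trans ((add_le_add e1 e2).trans ?_)
      rw [hA]
      linarith
    -- Rounding `t / τ` down to `n` loses less than one period, hence the factor `Real.exp α`.
    have h7 : ρ ^ n ≤ Real.exp α * Real.exp (-(α / τ) * t) := by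
      rw [hρα, ← Real.exp_add]
      refine Real.exp_le_exp.2 ?_
      have : α * (t / τ) ≤ α * (n + 1) := by gcongr
      rw [show -(α / τ) * t = -(α * (t / τ)) by ring]
      linarith
    have h8 : 0 ≤ Real.exp (-(α / τ) * t) * (‖x₀‖ + ‖z₀‖) := by positivity
    calc ‖S.state x₀ (c.input z) 0 t‖ ≤ A * (‖x n‖ + ‖z n‖) := h6
      _ ≤ A * (M * ρ ^ n * (‖x₀‖ + ‖z₀‖)) := by gcongr; exact hdecay n
      _ ≤ A * (M * (Real.exp α * Real.exp (-(α / τ) * t)) * (‖x₀‖ + ‖z₀‖)) := by gcongr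
      _ ≤ (A * M * Real.exp α + 1) * Real.exp (-(α / τ) * t) * (‖x₀‖ + ‖z₀‖) := by linarith
  · rw [← hρα]
    exact (le_add_of_nonneg_left (norm_nonneg _)).trans (hdecay n)

end ClosedLoopStability

end PeriodicSystem

end PeriodicORP

/-! ### The main theorem -/

theorem mainTheorem3 {τ : ℝ} {X U₀ Ud₀ Y₀ : Type*}
    [NormedAddCommGroup X] [NormedSpace ℂ X] [CompleteSpace X]
    [NormedAddCommGroup U₀] [InnerProductSpace ℂ U₀] [CompleteSpace U₀]
    [NormedAddCommGroup Ud₀] [InnerProductSpace ℂ Ud₀] [CompleteSpace Ud₀]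
    [NormedAddCommGroup Y₀] [InnerProductSpace ℂ Y₀] [CompleteSpace Y₀]
    (S : PeriodicORP.PeriodicSystem τ X U₀ Ud₀ Y₀) (hS : S.ExpStable)
    (hP : Function.Surjective S.steadyOperator)
    (G₂ : PeriodicORP.L2 τ Y₀ →L[ℂ] PeriodicORP.L2 τ Y₀) (hG₂ : G₂.IsInvertible)
    (K₀ : PeriodicORP.L2 τ Y₀ →L[ℂ] PeriodicORP.L2 τ U₀)
    (hK₀ : ∀ μ ∈ spectrum ℂ (G₂.comp (S.steadyOperator.comp K₀)), μ.re < 0) :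
    ∃ ε' : ℝ, 0 < ε' ∧ ∀ ε : ℝ, 0 < ε → ε ≤ ε' →
      ∀ (yref : ℝ → Y₀) (q : ℕ) (w : Fin q → ℝ → Ud₀),
        PeriodicORP.IsPeriodicSignal τ yref → (∀ k, PeriodicORP.IsPeriodicSignal τ (w k)) →
          S.SolvesRobustOutputRegulation
            { G₁ := ContinuousLinearMap.id ℂ (PeriodicORP.L2 τ Y₀)
              G₂ := G₂
              K := (ε : ℂ) • K₀ } yref w := by
  obtain ⟨m, hm, hT⟩ := hS.exists_norm_pow_lt_one
  obtain ⟨ε₀, hε₀, k, hk, hQk⟩ := PeriodicORP.exists_norm_one_add_smul_pow_lt_one _ hK₀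
  obtain ⟨ε', hε', hstable⟩ := PeriodicORP.exists_low_gain_stable hm hT
    (Ring.inverse_mul_cancel _ hS.isUnit_one_sub) (C := S.observeOp) (B := S.inputOp)
    (D := S.feedOp) (G := G₂) (K := K₀) (by rw [S.steadyOperator_eq]) hε₀ hk hQk
  obtain ⟨e, he⟩ := hG₂
  -- This bound concerns the controller alone, so it remains available for every perturbed system
  -- `S'`.
  have hbelow : ∀ y, ‖y‖ ≤ ‖(e.symm : PeriodicORP.L2 τ Y₀ →L[ℂ] PeriodicORP.L2 τ Y₀)‖ *
      ‖G₂ y‖ := by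
    intro y
    have h := (e.symm : PeriodicORP.L2 τ Y₀ →L[ℂ] PeriodicORP.L2 τ Y₀).le_opNorm (G₂ y)
    rw [← he] at h ⊢
    simpa using h
  refine ⟨ε', hε', fun ε hε hle yref q w hy hw => ?_⟩
  obtain ⟨ρ, M, hρ, hρ1, hM, hdecay⟩ := hstable ε hε hle
  have hcl := S.closedLoopExpStable_of_discrete (c :=
    { G₁ := ContinuousLinearMap.id ℂ (PeriodicORP.L2 τ Y₀), G₂ := G₂, K := (ε : ℂ) • K₀ })
    hρ hρ1 hM hdecay
  exact ⟨hcl, hcl.regulates rfl (norm_nonneg _) hbelow hy hw, fun S' hS' yref' q' w' hy' hw' =>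
    hS'.regulates rfl (norm_nonneg _) hbelow hy' hw'⟩
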